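/- Consider a dual-hop amplify-and-forward link with a single-antenna source, a relay with $N\ge 1$ antennas, and a single-antenna destination. The source power is $P_s$, the relay power $P_r$, the noise power at relay and destination $N_0>0$, and the relay is disturbed by $M\ge 1$ interferers of powers $P_{I1},\dots,P_{IM}>0$. The channel vectors $\mathbf h_1$ (source–relay, $N\times1$), $\mathbf h_2$ (relay–destination, $1\times N$) and $\mathbf h_{Ii}$ (interferer $i$–relay, $N\times 1$) have entries that are all i.i.d. $\mathcal{CN}(0,1)$. For a relay matrix $\mathbf W$ the end-to-end SINR is $$\gamma=\frac{|\mathbf h_2\mathbf W\mathbf h_1|^2P_s}{\sum_{i=1}^M|\mathbf h_2\mathbf W\mathbf h_{Ii}|^2P_{Ii}+\|\mathbf h_2\mathbf W\|^2N_0+N_0}.$$ The MRC/MRT scheme uses $\mathbf W=\omega\,\frac{\mathbf h_2^\dagger}{\|\mathbf h_2\|}\frac{\mathbf h_1^\dagger}{\|\mathbf h_1\|}$, where the relay power constraint gives $\omega^2=P_r\Big/\Big(\|\mathbf h_1\|^2P_s+\frac{\sum_i|\mathbf h_1^\dagger\mathbf h_{Ii}|^2P_{Ii}}{\|\mathbf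 h_1\|^2}+N_0\Big)$. Let $P_{\rm out}=\mathrm{Prob}(\gamma<\gamma_{\rm th})$ with a fixed threshold $\gamma_{\rm th}>0$, and put $\rho_1=P_s/N_0$, $\rho_2=P_r/N_0$, $\rho_{Ii}=P_{Ii}/N_0$. Let $\mathbf D=\mathrm{diag}(\rho_{I1},\dots,\rho_{IM})$ have the distinct diagonal entries $\rho_{I\langle1\rangle}>\dots>\rho_{I\langle\rho(\mathbf D)\rangle}$ with multiplicities $\tau_i(\mathbf D)$, and let $\chi_{i,j}(\mathbf D)$ be its characteristic coefficients, i.e. the coefficients of the partial fraction decomposition $\det(\mathbf I+v\mathbf D)^{-1}=\sum_{i=1}^{\rho(\mathbf D)}\sum_{j=1}^{\tau_i(\mathbf D)}\chi_{i,j}(\mathbf D)(1+v\rho_{I\langle i\rangle})^{-j}$. Let $\rho_2=\mu\rho_1$ with a constant $\mu>0$, keep the $\rho_{Ii}$ fixed, and let $\rho_1\to\infty$. Then $$P_{\rm out}=B\,\frac{(\gamma_{\rm th}/\rho_1)^N}{\Gamma(N+1)}+R(\rho_1),\qquad B=\frac1{\mu^N}+\sum_{k=0}^N\binom Nk\sum_{i=1}^{\rho(\mathbf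 D)}\sum_{j=1}^{\tau_i(\mathbf D)}\chi_{i,j}(\mathbf D)\frac{\Gamma(k+j)}{\Gamma(j)}\rho_{I\langle i\rangle}^k,$$ where $R(\rho_1)=o\big((\gamma_{\rm th}/\rho_1)^N\big)$; more precisely $R(\rho_1)=O\big((\gamma_{\rm th}/\rho_1)^{N+1}\big)$ if $N\ge2$, and $R(\rho_1)=O\big((\gamma_{\rm th}/\rho_1)^{2}\log\rho_1\big)$ if $N=1$. Hence the diversity order $\lim_{\rho_1\to\infty}-\log P_{\rm out}/\log\rho_1$ equals $N$, as it does for the same system without interferers, and interference affects only the array gain: $P_{\rm out}\sim(G\rho_1)^{-N}$ with $G=\frac1{\gamma_{\rm th}}\big(\Gamma(N+1)/B\big)^{1/N}$, whereas without interferers the outage probability is $\sim(G_0\rho_1)^{-N}$ with $G_0=\frac1{\gamma_{\rm th}}\big(\Gamma(N+1)/(\mu^{-N}+1)\big)^{1/N}$, and $0<G<G_0$. -/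

import Mathlib

open MeasureTheory ProbabilityTheory Filter Topology Asymptotics
open scoped Nat NNReal

noncomputable section

/-- The law `CN(0,1)` of a circular complex Gaussian variable with zero mean and unit variance:
real and imaginary part are independent real Gaussians with mean `0` and variance `1/2`. -/
def complexGaussian : Measure ℂ :=
  ((gaussianReal 0 (1 / 2 : ℝ≥0)).prod (gaussianReal 0 (1 / 2 : ℝ≥0))).map
    (fun p : ℝ × ℝ => (⟨p.1, p.2⟩ : ℂ))

/-- All scalar channel coefficients of the system as one family: those of the source-relay
channel `h₁`, of the relay-destination channel `h₂` and of the interferer-relay channels `hI i`. -/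
def channelEntries {Ω : Type*} {N M : ℕ} (h₁ h₂ : Ω → Fin N → ℂ)
    (hI : Fin M → Ω → Fin N → ℂ) : Fin N ⊕ Fin N ⊕ (Fin M × Fin N) → Ω → ℂ
  | Sum.inl n => fun ω => h₁ ω n
  | Sum.inr (Sum.inl n) => fun ω => h₂ ω n
  | Sum.inr (Sum.inr (i, n)) => fun ω => hI i ω n

/-- Independent Rayleigh fading: all channel coefficients are i.i.d. `CN(0,1)`. -/
structure IsRayleighFading {Ω : Type*} [MeasurableSpace Ω] (P : Measure Ω) {N M : ℕ}
    (h₁ h₂ : Ω → Fin N → ℂ) (hI : Fin M → Ω → Fin N → ℂ) : Prop where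
  measurable : ∀ k, Measurable (channelEntries h₁ h₂ hI k)
  law : ∀ k, P.map (channelEntries h₁ h₂ hI k) = complexGaussian
  indep : iIndepFun (channelEntries h₁ h₂ hI) P

/-- The squared Euclidean (Frobenius) norm of a complex vector. -/
def sqNorm {N : ℕ} (v : Fin N → ℂ) : ℝ := ∑ n, ‖v n‖ ^ 2

/-- The end-to-end SINR of the dual-hop amplify-and-forward system with relay matrix `W`,
`|h₂ W h₁|² Ps / (∑ i, |h₂ W hI i|² PI i + ‖h₂ W‖² N₀ + N₀)`. -/
def endToEndSINR {N M : ℕ} (Ps : ℝ) (PI : Fin M → ℝ) (N₀ : ℝ)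
    (W : Matrix (Fin N) (Fin N) ℂ) (h₁ h₂ : Fin N → ℂ) (hI : Fin M → Fin N → ℂ) : ℝ :=
  ‖h₂ ⬝ᵥ W.mulVec h₁‖ ^ 2 * Ps /
    (∑ i, ‖h₂ ⬝ᵥ W.mulVec (hI i)‖ ^ 2 * PI i + sqNorm (Matrix.vecMul h₂ W) * N₀ + N₀)

/-- The squared scaling factor of the MRC/MRT relay matrix that makes the average power
(over symbols and noise) transmitted by the relay equal to `Pr`. -/
def mrcScalingSq {N M : ℕ} (Ps Pr : ℝ) (PI : Fin M → ℝ) (N₀ : ℝ)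
    (h₁ : Fin N → ℂ) (hI : Fin M → Fin N → ℂ) : ℝ :=
  Pr / (sqNorm h₁ * Ps + (∑ i, ‖star h₁ ⬝ᵥ hI i‖ ^ 2 * PI i) / sqNorm h₁ + N₀)

/-- The MRC/MRT relay matrix `ω (h₂† / ‖h₂‖) (h₁† / ‖h₁‖)`: the column vector `h₂† / ‖h₂‖`
times the row vector `h₁† / ‖h₁‖`. -/
def mrcPrecoder {N M : ℕ} (Ps Pr : ℝ) (PI : Fin M → ℝ) (N₀ : ℝ)
    (h₁ h₂ : Fin N → ℂ) (hI : Fin M → Fin N → ℂ) : Matrix (Fin N) (Fin N) ℂ :=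
  ((Real.sqrt (mrcScalingSq Ps Pr PI N₀ h₁ hI) : ℝ) : ℂ) •
    Matrix.vecMulVec (fun n => star (h₂ n) / ((Real.sqrt (sqNorm h₂) : ℝ) : ℂ))
      (fun n => star (h₁ n) / ((Real.sqrt (sqNorm h₁) : ℝ) : ℂ))

/-- The instantaneous end-to-end SINR of the MRC/MRT scheme. -/
def mrcSINR {N M : ℕ} (Ps Pr : ℝ) (PI : Fin M → ℝ) (N₀ : ℝ)
    (h₁ h₂ : Fin N → ℂ) (hI : Fin M → Fin N → ℂ) : ℝ :=
  endToEndSINR Ps PI N₀ (mrcPrecoder Ps Pr PI N₀ h₁ h₂ hI) h₁ h₂ hI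

/-- The outage probability `Prob(γ < γth)` of the MRC/MRT scheme. -/
def mrcOutage {Ω : Type*} [MeasurableSpace Ω] (P : Measure Ω) {N M : ℕ}
    (h₁ h₂ : Ω → Fin N → ℂ) (hI : Fin M → Ω → Fin N → ℂ)
    (Ps Pr : ℝ) (PI : Fin M → ℝ) (N₀ γth : ℝ) : ℝ :=
  P.real {ω | mrcSINR Ps Pr PI N₀ (h₁ ω) (h₂ ω) (fun i => hI i ω) < γth}

/-- The distinct diagonal entries of `diag(d 0, …, d (M-1))`. -/
def distinctEntries {M : ℕ} (d : Fin M → ℝ) : Finset ℝ := Finset.univ.image d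

/-- The multiplicity of `a` among the diagonal entries `d`. -/
def entryMult {M : ℕ} (d : Fin M → ℝ) (a : ℝ) : ℕ := (Finset.univ.filter (fun i => d i = a)).card

/-- The characteristic coefficient of `D = diag d` for the distinct entry `a` (of multiplicity `τ`)
and `1 ≤ j ≤ τ`, i.e. the coefficient of `(1 + v a)⁻ʲ` in the partial fraction decomposition of
`det (1 + v D)⁻¹`:
`1 / ((τ - j)! a ^ (τ - j))` times the derivative of order `τ - j` of
`(1 + v a) ^ τ * det (1 + v D)⁻¹` at `v = -1 / a`, where the factor `(1 + v a) ^ τ` is cancelled. -/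
def charCoeff {M : ℕ} (d : Fin M → ℝ) (a : ℝ) (j : ℕ) : ℝ :=
  iteratedDeriv (entryMult d a - j)
      (fun v : ℝ => ∏ b ∈ (distinctEntries d).erase a, ((1 + v * b) ^ entryMult d b)⁻¹) (-1 / a) /
    (((entryMult d a - j)! : ℝ) * a ^ (entryMult d a - j))

/-- The bracket `μ⁻ᴺ + ∑ₖ C(N,k) ∑ᵢ ∑ⱼ χᵢⱼ(D) Γ(k+j)/Γ(j) ρᵢᵏ`; the sum over `i` runs over the
distinct interference-to-noise ratios. -/
def mrcBracket (N : ℕ) {M : ℕ} (μ : ℝ) (ρI : Fin M → ℝ) : ℝ :=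
  1 / μ ^ N + ∑ k ∈ Finset.range (N + 1), (N.choose k : ℝ) *
    ∑ a ∈ distinctEntries ρI, ∑ j ∈ Finset.Icc 1 (entryMult ρI a),
      charCoeff ρI a j * (Real.Gamma ((k : ℝ) + j) / Real.Gamma j) * a ^ k

/-- `Pout` has diversity order `d`: `-log Pout(ρ) / log ρ → d` as the SNR `ρ` tends to infinity. -/
def HasDiversityOrder (Pout : ℝ → ℝ) (d : ℝ) : Prop :=
  Tendsto (fun ρ : ℝ => -Real.log (Pout ρ) / Real.log ρ) atTop (𝓝 d)

/-- `Pout` has array gain `G > 0` at diversity order `d`: `Pout(ρ) ~ (G ρ)⁻ᵈ` as `ρ → ∞`. -/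
def HasArrayGain (Pout : ℝ → ℝ) (d : ℕ) (G : ℝ) : Prop :=
  0 < G ∧ Pout ~[atTop] (fun ρ : ℝ => ((G * ρ) ^ d)⁻¹)

end

/-! Put `X = ‖h₁‖²`, `Y = ‖h₂‖²`, `ε = γth / ρ₁`, and let `U` be one plus the interference-to-noise
ratio after combining. The MRC/MRT matrix has rank one, so the SINR depends on `X`, `Y`, `U` only,
and outage is the event `(X - ε U) (Y - ε / μ) < k ε² U` with `k = (γth + 1) / (γth μ)`
(`mrcSINR_lt_iff`). Given `h₁ ≠ 0`, the projections of the interferer channels on `h₁ / ‖h₁‖` are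
again i.i.d. `CN(0,1)`. Hence `X`, `Y`, `U` are independent: `X` and `Y` are Gamma of shape `N`, and
`U - 1` is a weighted sum of unit exponentials (`measurePreserving_channelGains`).

To leading order outage means that one hop fails alone, `X ≤ ε U` or `Y ≤ ε / μ`. As the Gamma
distribution function is `x ^ N / N! + O(x ^ (N + 1))`, these events contribute `E[U ^ N] ε ^ N /
N!` and `(ε / μ) ^ N / N!`. Everything else, including the overlap, costs `ε ^ (N + 1)` times a
negative moment of a Gamma variable truncated at order `ε` (`abs_two_hop_outage_sub_le`). That
moment is bounded for `N ≥ 2` and logarithmic for `N = 1`, which explains the two remainder orders.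

The bracket is `1 / μ ^ N + E[U ^ N]` (`mrcBracket_eq`): the moment-generating function of `U - 1`
is `det (1 - t D)⁻¹`, and differentiating its partial fractions at `0` gives the moments. Without
interferers `U = 1`; with them `U > 1` almost surely, so the array gain strictly drops. -/

noncomputable section

/-! ### Partial fractions and the characteristic coefficients. -/

section PartialFractions

open Polynomial

/-- The iterated derivatives of the function of a real polynomial are the functions of its formal
iterated derivatives. -/
lemma iteratedDeriv_polynomial_eval (p : ℝ[X]) (m : ℕ) :
    iteratedDeriv m (fun v => p.eval v) = fun v => (derivative^[m] p).eval v := by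
  induction m generalizing p with
  | zero => simp
  | succ m ih =>
    rw [iteratedDeriv_succ', Function.iterate_succ_apply, ← ih]
    congr 1
    funext v
    simp

/-- A real polynomial whose derivatives of order less than `τ` vanish at `c` is divisible by
`(X - c) ^ τ`. -/
lemma X_sub_C_pow_dvd_of_iteratedDeriv_eq_zero {p : ℝ[X]} {c : ℝ} {τ : ℕ}
    (h : ∀ m < τ, iteratedDeriv m (fun v => p.eval v) c = 0) : (X - C c) ^ τ ∣ p := by
  rcases eq_or_ne p 0 with rfl | hp
  · exact dvd_zero _
  rcases Nat.eq_zero_or_pos τ with rfl | hτ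
  · simp
  rw [← le_rootMultiplicity_iff hp]
  have : τ - 1 < p.rootMultiplicity c := by
    refine lt_rootMultiplicity_of_isRoot_iterate_derivative_of_mem_nonZeroDivisors hp
      (fun m hm => ?_) (mem_nonZeroDivisors_of_ne_zero (by positivity))
    have := h m (by omega)
    rwa [iteratedDeriv_polynomial_eval] at this
  omega

/-- Up to the factor `a ^ k` this is a power of `v - (-1 / a)`, so at the pole only the derivative
of order `k` survives. -/
lemma iteratedDeriv_one_add_mul_pow {a : ℝ} (ha : a ≠ 0) (i k : ℕ) :
    iteratedDeriv i (fun v : ℝ => (1 + v * a) ^ k) (-1 / a) = if i = k then a ^ k * k ! else 0 := by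
  have h1 : (fun v : ℝ => (1 + v * a) ^ k) = fun v => a ^ k * (fun w => w ^ k) (v - -1 / a) := by
    funext v
    simp only
    rw [← mul_pow]
    congr 1
    field_simp
    ring
  rw [h1, iteratedDeriv_const_mul_field, iteratedDeriv_comp_sub_const i (fun w : ℝ => w ^ k)]
  simp only [sub_self, iteratedDeriv_fun_pow_zero]
  split_ifs <;> simp

/-- The coefficient of `(1 + v a)⁻ʲ` in the partial fraction decomposition of
`∏ b ∈ S, (1 + v b) ^ (-τ b)`. -/
def partialFractionCoeff (S : Finset ℝ) (τ : ℝ → ℕ) (a : ℝ) (j : ℕ) : ℝ :=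
  iteratedDeriv (τ a - j) (fun v : ℝ => ∏ b ∈ S.erase a, ((1 + v * b) ^ τ b)⁻¹) (-1 / a) /
    (((τ a - j)! : ℝ) * a ^ (τ a - j))

/-- The numerator over `(1 + v a) ^ τ a` in the partial fraction decomposition of
`∏ b ∈ S, (1 + v b) ^ (-τ b)`. -/
def partialFractionNumerator (S : Finset ℝ) (τ : ℝ → ℕ) (a : ℝ) : ℝ[X] :=
  ∑ j ∈ Finset.Icc 1 (τ a), C (partialFractionCoeff S τ a j) * (1 + X * C a) ^ (τ a - j)

/-- The numerator is the Taylor polynomial of the cofactor at the pole, of degree below `τ a`,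
written in powers of `1 + v a`. -/
lemma iteratedDeriv_partialFractionNumerator (S : Finset ℝ) (τ : ℝ → ℕ) {a : ℝ} (ha : a ≠ 0)
    {i : ℕ} (hi : i < τ a) :
    iteratedDeriv i (fun v => (partialFractionNumerator S τ a).eval v) (-1 / a) =
      iteratedDeriv i (fun v : ℝ => ∏ b ∈ S.erase a, ((1 + v * b) ^ τ b)⁻¹) (-1 / a) := by
  have h1 : (fun v => (partialFractionNumerator S τ a).eval v) =
      fun v => ∑ j ∈ Finset.Icc 1 (τ a), partialFractionCoeff S τ a j * (1 + v * a) ^ (τ a - j) := by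
    funext v
    simp only [partialFractionNumerator, eval_finsetSum, eval_mul, eval_C, eval_pow, eval_add,
      eval_one, eval_X]
  rw [h1, iteratedDeriv_fun_sum (fun j _ => by fun_prop)]
  simp only [iteratedDeriv_const_mul_field, iteratedDeriv_one_add_mul_pow ha]
  rw [Finset.sum_eq_single (τ a - i)]
  · have : τ a - (τ a - i) = i := by omega
    rw [this, if_pos rfl, partialFractionCoeff, this]
    field_simp
  · intro j hj hne
    rw [Finset.mem_Icc] at hj
    rw [if_neg (by omega), mul_zero]
  · intro h
    exact absurd (Finset.mem_Icc.2 ⟨by omega, by omega⟩) h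

lemma isCoprime_one_add_X_mul_C {a b : ℝ} (h : a ≠ b) :
    IsCoprime (1 + X * C a : ℝ[X]) (1 + X * C b) := by
  refine ⟨C (b / (b - a)), - C (a / (b - a)), ?_⟩
  have h' : b - a ≠ 0 := sub_ne_zero.2 h.symm
  apply Polynomial.funext
  intro v
  simp
  field_simp
  ring

/-- Near the pole the numerator agrees with the inverse of the remaining product up to order `τ a`,
so their product minus one vanishes there to that order. -/
lemma one_add_X_mul_C_pow_dvd (S : Finset ℝ) (τ : ℝ → ℕ) {a : ℝ} (ha : a ≠ 0) :
    (1 + X * C a) ^ τ a ∣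
      partialFractionNumerator S τ a * ∏ b ∈ S.erase a, (1 + X * C b) ^ τ b - 1 := by
  have hfac : (1 + X * C a : ℝ[X]) = C a * (X - C (-1 / a)) := by
    apply Polynomial.funext
    intro v
    simp
    field_simp
    ring
  rw [hfac, mul_pow, ← C_pow]
  refine (IsUnit.mul_left_dvd (isUnit_C.2 (pow_ne_zero _ ha).isUnit)).2 ?_
  refine X_sub_C_pow_dvd_of_iteratedDeriv_eq_zero fun m hm => ?_
  set T := partialFractionNumerator S τ a with hT
  set G : ℝ[X] := ∏ b ∈ S.erase a, (1 + X * C b) ^ τ b with hG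
  set g : ℝ → ℝ := fun v : ℝ => ∏ b ∈ S.erase a, ((1 + v * b) ^ τ b)⁻¹ with hg
  have hb0 : ∀ b ∈ S.erase a, 1 + (-1 / a) * b ≠ 0 := by
    intro b hb h0
    have : b = a := by
      field_simp at h0
      linarith
    exact (Finset.mem_erase.1 hb).1 this
  have hgc : ContDiffAt ℝ m g (-1 / a) := by
    refine contDiffAt_prod fun b hb => ContDiffAt.inv (by fun_prop) (pow_ne_zero _ (hb0 b hb))
  have hTc : ContDiffAt ℝ m (fun v => T.eval v) (-1 / a) := 
    (Polynomial.contDiff_aeval T m).contDiffAt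
  have hGc : ContDiffAt ℝ m (fun v => G.eval v) (-1 / a) := 
    (Polynomial.contDiff_aeval G m).contDiffAt
  -- The Leibniz rule only involves derivatives of order at most `m < τ a`, where numerator and
  -- cofactor agree.
  have hprod : iteratedDeriv m (fun v => T.eval v * G.eval v) (-1 / a) =
      iteratedDeriv m (fun v => g v * G.eval v) (-1 / a) := by
    rw [iteratedDeriv_fun_mul hTc hGc, iteratedDeriv_fun_mul hgc hGc]
    refine Finset.sum_congr rfl fun i hi => ?_
    rw [hT, iteratedDeriv_partialFractionNumerator S τ ha
      (by have := Finset.mem_range.1 hi; omega)]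
  have hone : (fun v => g v * G.eval v) =ᶠ[𝓝 (-1 / a)] fun _ => (1 : ℝ) := by
    have : ∀ᶠ v : ℝ in 𝓝 (-1 / a), ∀ b ∈ S.erase a, 1 + v * b ≠ 0 := by
      rw [Filter.eventually_all_finset]
      intro b hb
      have hc : ContinuousAt (fun v : ℝ => 1 + v * b) (-1 / a) := by fun_prop
      exact hc.eventually_ne (hb0 b hb)
    filter_upwards [this] with v hv
    simp only [hg, hG, eval_prod, eval_pow, eval_add, eval_one, eval_mul, eval_X, eval_C]
    rw [← Finset.prod_mul_distrib]
    exact Finset.prod_eq_one fun b hb => inv_mul_cancel₀ (pow_ne_zero _ (hv b hb))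
  have hsub : (fun v => (T * G - 1).eval v) = fun v => T.eval v * G.eval v - 1 := by
    funext v
    simp
  rw [hsub, iteratedDeriv_fun_sub (hTc.mul hGc) contDiffAt_const, hprod,
    hone.iteratedDeriv_eq, sub_self]

lemma natDegree_one_add_X_mul_C_pow {a : ℝ} (ha : a ≠ 0) (k : ℕ) :
    ((1 + X * C a : ℝ[X]) ^ k).natDegree = k := by
  have : (1 + X * C a : ℝ[X]) = C a * X + C 1 := by simp; ring
  rw [natDegree_pow, this, natDegree_linear ha, mul_one]

/-- The difference of the two sides is divisible by each of the pairwise coprime factors, hence by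
their product, whose degree exceeds that of the difference. -/
lemma sum_partialFractionNumerator_mul_prod {S : Finset ℝ} {τ : ℝ → ℕ} (hS : S.Nonempty)
    (h0 : ∀ a ∈ S, a ≠ 0) (hτ : ∀ a ∈ S, 1 ≤ τ a) :
    ∑ a ∈ S, partialFractionNumerator S τ a * ∏ b ∈ S.erase a, (1 + X * C b) ^ τ b = 1 := by
  set F := ∑ a ∈ S, partialFractionNumerator S τ a * ∏ b ∈ S.erase a, (1 + X * C b) ^ τ b with hF
  have hne : ∀ a : ℝ, (1 + X * C a : ℝ[X]) ≠ 0 := fun a h => by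
    have := congrArg (eval 0) h
    simp at this
  have hdvd : ∏ a ∈ S, (1 + X * C a) ^ τ a ∣ F - 1 := by
    refine Finset.prod_dvd_of_coprime (fun a _ b _ hab => ?_) fun a ha => ?_
    · exact (isCoprime_one_add_X_mul_C hab).pow
    -- Modulo `(1 + a X) ^ τ a` only the summand of `a` survives.
    · rw [hF, ← Finset.add_sum_erase _ _ ha, add_sub_right_comm]
      refine dvd_add (one_add_X_mul_C_pow_dvd S τ (h0 a ha)) (Finset.dvd_sum fun b hb => ?_)
      refine Dvd.dvd.mul_left (Finset.dvd_prod_of_mem (fun c => (1 + X * C c : ℝ[X]) ^ τ c) ?_) _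
      exact Finset.mem_erase.2 ⟨(Finset.mem_erase.1 hb).1.symm, ha⟩
  have hdeg : (∏ a ∈ S, (1 + X * C a : ℝ[X]) ^ τ a).natDegree = ∑ a ∈ S, τ a := by
    rw [natDegree_prod _ _ fun a _ => pow_ne_zero _ (hne a)]
    exact Finset.sum_congr rfl fun a ha => natDegree_one_add_X_mul_C_pow (h0 a ha) _
  have hlt : (F - 1).natDegree < ∑ a ∈ S, τ a := by
    obtain ⟨a₀, ha₀⟩ := hS
    have hpos : 0 < ∑ a ∈ S, τ a :=
      lt_of_lt_of_le (hτ a₀ ha₀) (Finset.single_le_sum (fun _ _ => Nat.zero_le _) ha₀)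
    -- The total degree is positive, so the truncated subtraction really decreases it.
    refine lt_of_le_of_lt (b := ∑ a ∈ S, τ a - 1) ?_ (by omega)
    refine (natDegree_sub_le _ _).trans (max_le ?_ (by simp))
    refine natDegree_sum_le_of_forall_le _ _ fun a ha => ?_
    refine natDegree_mul_le.trans ?_
    have h1 : (partialFractionNumerator S τ a).natDegree ≤ τ a - 1 := by
      refine natDegree_sum_le_of_forall_le _ _ fun j hj => ?_
      refine (natDegree_C_mul_le _ _).trans ?_
      rw [natDegree_one_add_X_mul_C_pow (h0 a ha)]
      have := (Finset.mem_Icc.1 hj).1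
      omega
    have h2 : (∏ b ∈ S.erase a, (1 + X * C b : ℝ[X]) ^ τ b).natDegree = ∑ b ∈ S.erase a, τ b := by
      rw [natDegree_prod _ _ fun a _ => pow_ne_zero _ (hne a)]
      exact Finset.sum_congr rfl fun b hb =>
        natDegree_one_add_X_mul_C_pow (h0 b (Finset.mem_of_mem_erase hb)) _
    rw [h2, ← Finset.add_sum_erase _ _ ha]
    have := hτ a ha
    omega
  have := eq_zero_of_dvd_of_natDegree_lt hdvd (hdeg ▸ hlt)
  exact sub_eq_zero.1 this

/-- Partial fraction decomposition of `∏ b ∈ S, (1 + v b) ^ (-τ b)`. -/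
lemma prod_one_add_mul_pow_inv {S : Finset ℝ} {τ : ℝ → ℕ} (hS : S.Nonempty)
    (h0 : ∀ a ∈ S, a ≠ 0) (hτ : ∀ a ∈ S, 1 ≤ τ a) {v : ℝ} (hv : ∀ a ∈ S, 1 + v * a ≠ 0) :
    ∏ b ∈ S, ((1 + v * b) ^ τ b)⁻¹ =
      ∑ a ∈ S, ∑ j ∈ Finset.Icc 1 (τ a), partialFractionCoeff S τ a j * ((1 + v * a) ^ j)⁻¹ := by
  have h := congrArg (eval v) (sum_partialFractionNumerator_mul_prod hS h0 hτ)
  simp only [eval_finsetSum, eval_mul, eval_prod, eval_pow, eval_add, eval_one, eval_X,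
    eval_C, partialFractionNumerator] at h
  refine (one_mul _).symm.trans ?_
  refine (congrArg (· * ∏ b ∈ S, ((1 + v * b) ^ τ b)⁻¹) h.symm).trans ?_
  rw [Finset.sum_mul]
  refine Finset.sum_congr rfl fun a ha => ?_
  rw [← Finset.mul_prod_erase S (fun b => ((1 + v * b) ^ τ b)⁻¹) ha]
  have hP : (∏ b ∈ S.erase a, (1 + v * b) ^ τ b) * ∏ b ∈ S.erase a, ((1 + v * b) ^ τ b)⁻¹ = 1 := by
    rw [← Finset.prod_mul_distrib]
    exact Finset.prod_eq_one fun b hb =>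
      mul_inv_cancel₀ (pow_ne_zero _ (hv b (Finset.mem_of_mem_erase hb)))
  rw [mul_mul_mul_comm, mul_right_comm, mul_assoc, hP, one_mul, Finset.sum_mul]
  refine Finset.sum_congr rfl fun j hj => ?_
  have hj := Finset.mem_Icc.1 hj
  have hva := hv a ha
  rw [mul_assoc]
  congr 1
  rw [← div_eq_mul_inv, div_eq_iff (pow_ne_zero _ hva), eq_comm, inv_mul_eq_iff_eq_mul₀ (pow_ne_zero _ hva),
    ← pow_add]
  congr 1
  omega

/-- The characteristic coefficients of `diag d` are the coefficients of the partial fraction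
decomposition of `det (1 + v diag d)⁻¹`. -/
lemma prod_one_add_mul_inv_eq_sum_charCoeff {M : ℕ} (hM : 1 ≤ M) {d : Fin M → ℝ}
    (hd : ∀ i, d i ≠ 0) {v : ℝ} (hv : ∀ i, 1 + v * d i ≠ 0) :
    ∏ i, (1 + v * d i)⁻¹ = ∑ a ∈ distinctEntries d, ∑ j ∈ Finset.Icc 1 (entryMult d a),
      charCoeff d a j * ((1 + v * a) ^ j)⁻¹ := by
  have hmem : ∀ a ∈ distinctEntries d, ∃ i, d i = a := fun a ha => by
    simpa [distinctEntries] using ha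
  have key := prod_one_add_mul_pow_inv (S := distinctEntries d) (τ := entryMult d) (v := v)
    ?_ ?_ ?_ ?_
  · have hl : ∏ i, (1 + v * d i)⁻¹ =
        ∏ b ∈ distinctEntries d, ((1 + v * b) ^ entryMult d b)⁻¹ := by
      rw [distinctEntries, Finset.prod_comp (fun b => (1 + v * b)⁻¹) d]
      simp [entryMult]
    rw [hl, key]
    -- `charCoeff d` unfolds to `partialFractionCoeff` for the distinct entries with their
    -- multiplicities.
    rfl
  · exact ⟨d ⟨0, hM⟩, by simp [distinctEntries]⟩
  · intro a ha
    obtain ⟨i, rfl⟩ := hmem a ha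
    exact hd i
  · intro a ha
    obtain ⟨i, rfl⟩ := hmem a ha
    exact Finset.card_pos.2 ⟨i, by simp⟩
  · intro a ha
    obtain ⟨i, rfl⟩ := hmem a ha
    exact hv i

end PartialFractions


/-! ### Moments from the moment-generating function. -/

lemma iteratedDeriv_one_sub_mul_pow_inv (a : ℝ) (j k : ℕ) :
    Set.EqOn (iteratedDeriv k (fun t : ℝ => ((1 - t * a) ^ j)⁻¹))
      (fun t => a ^ k * (j.ascFactorial k : ℝ) * ((1 - t * a) ^ (j + k))⁻¹)
      {t | 1 - t * a ≠ 0} := by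
  have hopen : IsOpen {t : ℝ | 1 - t * a ≠ 0} :=
    isOpen_ne_fun (by fun_prop) continuous_const
  induction k with
  | zero => intro t _; simp
  | succ k ih =>
    intro t ht
    have ht' : 1 - t * a ≠ 0 := ht
    rw [iteratedDeriv_succ, (ih.eventuallyEq_of_mem (hopen.mem_nhds ht)).deriv_eq]
    have h1 : HasDerivAt (fun t : ℝ => 1 - t * a) (-(1 * a)) t :=
      ((hasDerivAt_id t).mul_const a).const_sub 1
    have h2 := ((h1.pow (j + k)).inv (pow_ne_zero _ ht')).const_mul
      (a ^ k * (j.ascFactorial k : ℝ))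
    refine (HasDerivAt.deriv h2).trans ?_
    rw [Nat.ascFactorial_succ]
    -- The power rule produces the exponent `j + k - 1`, whose truncated subtraction is harmless
    -- only for `j + k > 0`; otherwise the function is constant.
    rcases Nat.eq_zero_or_pos (j + k) with h0 | h0
    · obtain ⟨rfl, rfl⟩ : j = 0 ∧ k = 0 := by omega
      simp
    · obtain ⟨m, hm⟩ : ∃ m, j + k = m + 1 := ⟨j + k - 1, by omega⟩
      have hm' : j + (k + 1) = m + 2 := by omega
      rw [hm, hm']
      simp only [Pi.pow_apply, Nat.add_sub_cancel]
      field_simp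
      push_cast
      ring

lemma Gamma_nat_add_div_Gamma (k : ℕ) {j : ℕ} (hj : 1 ≤ j) :
    Real.Gamma ((k : ℝ) + j) / Real.Gamma j = j.ascFactorial k := by
  have hj0 : (0 : ℝ) < j := by exact_mod_cast hj
  rw [div_eq_iff (Real.Gamma_pos_of_pos hj0).ne']
  induction k with
  | zero => simp
  | succ k ih =>
    have : ((k + 1 : ℕ) : ℝ) + j = ((k : ℝ) + j) + 1 := by push_cast; ring
    rw [this, Real.Gamma_add_one (by positivity), ih, Nat.ascFactorial_succ]
    push_cast
    ring

/-- The moments of a random variable whose moment-generating function is `det (1 - t diag d)⁻¹`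
near `0`, in terms of the characteristic coefficients of `diag d`. -/
lemma moment_eq_sum_charCoeff {Ω : Type*} [MeasurableSpace Ω] {P : Measure Ω} {Z : Ω → ℝ}
    {M : ℕ} (hM : 1 ≤ M) {d : Fin M → ℝ} (hd : ∀ i, d i ≠ 0)
    (hint : 0 ∈ interior (integrableExpSet Z P))
    (hmgf : ∀ᶠ t in 𝓝 (0 : ℝ), mgf Z P t = ∏ i, (1 - t * d i)⁻¹) (k : ℕ) :
    ∫ ω, Z ω ^ k ∂P = ∑ a ∈ distinctEntries d, ∑ j ∈ Finset.Icc 1 (entryMult d a),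
      charCoeff d a j * (Real.Gamma ((k : ℝ) + j) / Real.Gamma j) * a ^ k := by
  have h1 : ∀ᶠ t in 𝓝 (0 : ℝ), ∀ i, 1 - t * d i ≠ 0 := by
    rw [Filter.eventually_all]
    intro i
    have hc : ContinuousAt (fun t : ℝ => 1 - t * d i) 0 := by fun_prop
    exact hc.eventually_ne (by simp)
  have h2 : mgf Z P =ᶠ[𝓝 0] fun t => ∑ a ∈ distinctEntries d, ∑ j ∈ Finset.Icc 1 (entryMult d a),
      charCoeff d a j * ((1 - t * a) ^ j)⁻¹ := by
    filter_upwards [hmgf, h1] with t ht1 ht2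
    have := prod_one_add_mul_inv_eq_sum_charCoeff hM hd (v := -t)
      (fun i => by simpa [← sub_eq_add_neg] using ht2 i)
    simp only [neg_mul, ← sub_eq_add_neg] at this
    rw [ht1, this]
  have h3 := iteratedDeriv_mgf_zero hint k
  simp only [Pi.pow_apply] at h3
  have hcd : ∀ (a : ℝ) (j : ℕ), ContDiffAt ℝ k (fun t : ℝ => ((1 - t * a) ^ j)⁻¹) 0 :=
    fun a j => ContDiffAt.inv (by fun_prop) (by simp)
  -- The moment is the `k`-th derivative of the moment-generating function at `0`, so its partial
  -- fractions near `0` suffice.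
  rw [← h3, h2.iteratedDeriv_eq, iteratedDeriv_fun_sum fun a _ =>
    ContDiffAt.sum fun j _ => contDiffAt_const.mul (hcd a j)]
  refine Finset.sum_congr rfl fun a _ => ?_
  rw [iteratedDeriv_fun_sum fun j _ => contDiffAt_const.mul (hcd a j)]
  refine Finset.sum_congr rfl fun j hj => ?_
  rw [iteratedDeriv_const_mul_field,
    iteratedDeriv_one_sub_mul_pow_inv a j k (by simp : (0 : ℝ) ∈ {t : ℝ | 1 - t * a ≠ 0}),
    Gamma_nat_add_div_Gamma k (Finset.mem_Icc.1 hj).1]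
  simp
  ring

lemma integral_one_add_pow {Ω : Type*} [MeasurableSpace Ω] {P : Measure Ω} {Z : Ω → ℝ}
    (hint : 0 ∈ interior (integrableExpSet Z P)) (N : ℕ) :
    ∫ ω, (1 + Z ω) ^ N ∂P = ∑ k ∈ Finset.range (N + 1), (N.choose k : ℝ) * ∫ ω, Z ω ^ k ∂P := by
  simp only [add_comm (1 : ℝ), add_pow, one_pow, mul_one]
  rw [integral_finsetSum _ fun k _ => (integrable_pow_of_mem_interior_integrableExpSet hint k).mul_const _]
  refine Finset.sum_congr rfl fun k _ => ?_
  rw [integral_mul_const, mul_comm]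

lemma integrable_one_add_pow {Ω : Type*} [MeasurableSpace Ω] {P : Measure Ω} {Z : Ω → ℝ}
    (hint : 0 ∈ interior (integrableExpSet Z P)) (N : ℕ) :
    Integrable (fun ω => (1 + Z ω) ^ N) P := by
  simp only [add_comm (1 : ℝ), add_pow, one_pow, mul_one]
  exact integrable_finsetSum _ fun k _ =>
    (integrable_pow_of_mem_interior_integrableExpSet hint k).mul_const _

/-- The explicit double sums are the moments of `Z`, and the outer sum is the binomial expansion of
`(1 + Z) ^ N`. -/
lemma mrcBracket_eq_integral {Ω : Type*} [MeasurableSpace Ω] {P : Measure Ω} {Z : Ω → ℝ}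
    {M : ℕ} (hM : 1 ≤ M) {d : Fin M → ℝ} (hd : ∀ i, d i ≠ 0)
    (hint : 0 ∈ interior (integrableExpSet Z P))
    (hmgf : ∀ᶠ t in 𝓝 (0 : ℝ), mgf Z P t = ∏ i, (1 - t * d i)⁻¹) (N : ℕ) (μ : ℝ) :
    mrcBracket N μ d = 1 / μ ^ N + ∫ ω, (1 + Z ω) ^ N ∂P := by
  rw [mrcBracket, integral_one_add_pow hint]
  simp only [moment_eq_sum_charCoeff hM hd hint hmgf]


/-! ### The Gamma distribution with integer shape. -/

section Gamma

open Set
open scoped ENNReal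

/-- The density of the Gamma distribution with shape `n + 1` and rate `1`. -/
def erlangPDF (n : ℕ) (x : ℝ) : ℝ := x ^ n / n ! * Real.exp (-x)

/-- The Gamma distribution with shape `n + 1` and rate `1`. -/
def erlang (n : ℕ) : Measure ℝ :=
  (volume.restrict (Ioi 0)).withDensity fun x => ENNReal.ofReal (erlangPDF n x)

@[fun_prop]
lemma continuous_erlangPDF (n : ℕ) : Continuous (erlangPDF n) := by
  unfold erlangPDF
  fun_prop

lemma erlangPDF_nonneg (n : ℕ) {x : ℝ} (hx : 0 ≤ x) : 0 ≤ erlangPDF n x := by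
  unfold erlangPDF
  positivity

lemma erlangPDF_le_pow_div (n : ℕ) {x : ℝ} (hx : 0 ≤ x) : erlangPDF n x ≤ x ^ n / n ! := by
  unfold erlangPDF
  exact mul_le_of_le_one_right (by positivity) (Real.exp_le_one_iff.2 (by linarith))

lemma pow_div_factorial_le (n : ℕ) {x : ℝ} (hx : 0 ≤ x) : x ^ n / n ! ≤ x ^ n :=
  div_le_self (by positivity) (by exact_mod_cast Nat.one_le_iff_ne_zero.2 n.factorial_ne_zero)

/-- Induction by parts. The rate is complex so that characteristic function, moment-generating
function and total mass all follow from one formula. -/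
lemma integral_pow_mul_cexp_neg (n : ℕ) {w : ℂ} (hw : 0 < w.re) :
    IntegrableOn (fun x : ℝ => (x : ℂ) ^ n * Complex.exp (-w * x)) (Ioi 0) ∧
      ∫ x in Ioi (0 : ℝ), (x : ℂ) ^ n * Complex.exp (-w * x) = n ! * (w⁻¹) ^ (n + 1) := by
  have hw0 : w ≠ 0 := fun h => by simp [h] at hw
  have hint : ∀ n : ℕ, IntegrableOn (fun x : ℝ => (x : ℂ) ^ n * Complex.exp (-w * x)) (Ioi 0) := by
    intro n
    have h := integrableOn_rpow_mul_exp_neg_mul_rpow (p := 1) (s := n) (b := w.re)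
      (by have : (0 : ℝ) ≤ n := by positivity
          linarith) one_pos hw
    refine Integrable.mono' h (by fun_prop) ?_
    refine (ae_restrict_mem measurableSet_Ioi).mono fun x hx => le_of_eq ?_
    have hx : 0 < x := hx
    simp [Complex.norm_exp, abs_of_pos hx]
  refine ⟨hint n, ?_⟩
  induction n with
  | zero =>
    have := integral_exp_mul_complex_Ioi (a := -w) (by simpa using hw) 0
    simpa using this
  | succ n ih =>
    -- The boundary terms vanish at `0` and at infinity, so this derivative links the integrals for
    -- `n + 1` and `n`.
    have hderiv : ∀ x ∈ Ici (0 : ℝ), HasDerivAt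
        (fun x : ℝ => -(w⁻¹) * ((x : ℂ) ^ (n + 1) * Complex.exp (-w * x)))
        ((x : ℂ) ^ (n + 1) * Complex.exp (-w * x) -
          ((n + 1 : ℕ) : ℂ) * w⁻¹ * ((x : ℂ) ^ n * Complex.exp (-w * x))) x := by
      intro x _
      have h1 : HasDerivAt (fun x : ℂ => x ^ (n + 1) * Complex.exp (-w * x))
          (((n + 1 : ℕ) : ℂ) * (x : ℂ) ^ n * Complex.exp (-w * x) +
            (x : ℂ) ^ (n + 1) * (Complex.exp (-w * x) * (-w * 1))) x := by
        exact (hasDerivAt_pow (n + 1) (x : ℂ)).mul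
          (((hasDerivAt_id (x : ℂ)).const_mul (-w)).cexp)
      have h2 := (h1.const_mul (-(w⁻¹))).comp_ofReal
      refine h2.congr_deriv ?_
      field_simp
      ring
    have hlim : Tendsto (fun x : ℝ => -(w⁻¹) * ((x : ℂ) ^ (n + 1) * Complex.exp (-w * x)))
        atTop (𝓝 0) := by
      rw [← mul_zero (-(w⁻¹))]
      refine Tendsto.const_mul _ ?_
      rw [tendsto_zero_iff_norm_tendsto_zero]
      refine (tendsto_rpow_mul_exp_neg_mul_atTop_nhds_zero (n + 1 : ℕ) w.re hw).congr' ?_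
      filter_upwards [eventually_gt_atTop 0] with x hx
      rw [norm_mul, Complex.norm_exp, norm_pow, Complex.norm_real, Real.norm_of_nonneg hx.le,
        Real.rpow_natCast]
      simp
    have h := integral_Ioi_of_hasDerivAt_of_tendsto' hderiv
      ((hint (n + 1)).sub ((hint n).const_mul _)) hlim
    rw [integral_sub (hint (n + 1)) ((hint n).const_mul _), integral_const_mul, ih] at h
    simp only [Complex.ofReal_zero, ne_eq, Nat.add_eq_zero_iff, one_ne_zero, and_false,
      not_false_eq_true, zero_pow, zero_mul, mul_zero, sub_zero, sub_eq_zero] at h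
    rw [h, Nat.factorial_succ]
    push_cast
    ring

lemma integral_cexp_mul_pow_mul_exp_neg (n : ℕ) {z : ℂ} (hz : z.re < 1) :
    ∫ x in Ioi (0 : ℝ), (erlangPDF n x : ℂ) * Complex.exp (z * x) = ((1 - z)⁻¹) ^ (n + 1) := by
  have h := (integral_pow_mul_cexp_neg n (w := 1 - z) (by simpa using hz)).2
  have h2 : ∀ x : ℝ, (erlangPDF n x : ℂ) * Complex.exp (z * x) =
      (n ! : ℂ)⁻¹ * ((x : ℂ) ^ n * Complex.exp (-(1 - z) * x)) := by
    intro x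
    have : Complex.exp (-(1 - z) * x) = Complex.exp (-x) * Complex.exp (z * x) := by
      rw [← Complex.exp_add]
      ring_nf
    rw [this, erlangPDF]
    push_cast
    ring
  simp only [h2]
  rw [integral_const_mul, h]
  have h3 : (n ! : ℂ) ≠ 0 := by exact_mod_cast n.factorial_ne_zero
  field_simp

lemma integrable_erlangPDF_mul_exp (n : ℕ) {t : ℝ} (ht : t < 1) :
    IntegrableOn (fun x => erlangPDF n x * Real.exp (t * x)) (Ioi 0) := by
  have h := integrableOn_rpow_mul_exp_neg_mul_rpow (p := 1) (s := n) (b := 1 - t)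
    (by have : (0 : ℝ) ≤ n := by positivity
        linarith) one_pos (by linarith)
  refine IntegrableOn.congr_fun (h.const_mul ((n ! : ℝ)⁻¹)) (fun x hx => ?_) measurableSet_Ioi
  have : Real.exp (-(1 - t) * x) = Real.exp (-x) * Real.exp (t * x) := by
    rw [← Real.exp_add]
    ring_nf
  simp only [Real.rpow_natCast, Real.rpow_one, erlangPDF, this]
  ring

lemma integral_erlangPDF (n : ℕ) : ∫ x in Ioi (0 : ℝ), erlangPDF n x = 1 := by
  have := integral_cexp_mul_pow_mul_exp_neg n (z := 0) (by simp)
  simp only [zero_mul, Complex.exp_zero, mul_one, sub_zero, inv_one, one_pow] at this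
  exact Complex.ofReal_injective ((integral_ofReal (𝕜 := ℂ)).symm.trans (by simpa using this))

instance (n : ℕ) : IsProbabilityMeasure (erlang n) := by
  constructor
  have hint : IntegrableOn (erlangPDF n) (Ioi 0) := by
    simpa using integrable_erlangPDF_mul_exp n (t := 0) (by norm_num)
  rw [erlang, withDensity_apply _ MeasurableSet.univ, Measure.restrict_univ,
    ← ofReal_integral_eq_lintegral_ofReal hint, integral_erlangPDF, ENNReal.ofReal_one]
  exact (ae_restrict_mem measurableSet_Ioi).mono fun x hx => erlangPDF_nonneg n (le_of_lt hx)

lemma ae_pos_erlang (n : ℕ) : ∀ᵐ x ∂erlang n, 0 < x :=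
  (withDensity_absolutelyContinuous _ _).ae_le (ae_restrict_mem measurableSet_Ioi)

lemma charFun_erlang (n : ℕ) (t : ℝ) :
    charFun (erlang n) t = ((1 - t * Complex.I)⁻¹) ^ (n + 1) := by
  rw [charFun_apply_real, erlang, integral_withDensity_eq_integral_toReal_smul₀
    (by fun_prop) (by simp), ← integral_cexp_mul_pow_mul_exp_neg n (by simp)]
  refine setIntegral_congr_fun measurableSet_Ioi fun x hx => ?_
  simp only [ENNReal.toReal_ofReal (erlangPDF_nonneg n (le_of_lt hx)), Complex.real_smul]
  congr 2
  ring

lemma erlang_apply (n : ℕ) {s : Set ℝ} (hs : MeasurableSet s) :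
    erlang n s = ∫⁻ x in s ∩ Ioi 0, ENNReal.ofReal (erlangPDF n x) := by
  rw [erlang, withDensity_apply _ hs, Measure.restrict_restrict hs]

lemma erlang_Ioc_le (n : ℕ) {c d : ℝ} (hd : 0 ≤ d) :
    erlang n (Ioc c d) ≤ ENNReal.ofReal (d ^ n * (d - c)) := by
  rw [erlang_apply n measurableSet_Ioc]
  calc ∫⁻ x in Ioc c d ∩ Ioi 0, ENNReal.ofReal (erlangPDF n x)
      ≤ ∫⁻ _ in Ioc c d ∩ Ioi 0, ENNReal.ofReal (d ^ n) := by
        refine setLIntegral_mono' (by measurability) fun x hx => ENNReal.ofReal_le_ofReal ?_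
        have hx0 : 0 ≤ x := le_of_lt hx.2
        exact (erlangPDF_le_pow_div n hx0).trans
          ((pow_div_factorial_le n hx0).trans (pow_le_pow_left₀ hx0 hx.1.2 n))
    _ ≤ ∫⁻ _ in Ioc c d, ENNReal.ofReal (d ^ n) := lintegral_mono_set inter_subset_left
    _ = ENNReal.ofReal (d ^ n * (d - c)) := by
        rw [setLIntegral_const, Real.volume_Ioc, ENNReal.ofReal_mul (by positivity)]

lemma erlang_Iic_eq_Ioc (n : ℕ) (x : ℝ) : erlang n (Iic x) = erlang n (Ioc 0 x) := by
  rw [erlang_apply n measurableSet_Iic, erlang_apply n measurableSet_Ioc]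
  congr 2
  ext y
  simp only [mem_inter_iff, mem_Iic, mem_Ioi, mem_Ioc]
  tauto

lemma erlang_Iic_le (n : ℕ) {x : ℝ} (hx : 0 ≤ x) :
    erlang n (Iic x) ≤ ENNReal.ofReal (x ^ (n + 1)) := by
  rw [erlang_Iic_eq_Ioc]
  refine (erlang_Ioc_le n hx).trans (le_of_eq ?_)
  rw [sub_zero, pow_succ]

/-- Below `1` a smaller exponent weakens the power bound; above `1` the trivial bound by one
suffices. The freedom in `p` later keeps a negative moment integrable. -/
lemma erlang_Iic_le_rpow (n : ℕ) {x p : ℝ} (hx : 0 ≤ x) (hp0 : 0 ≤ p) (hp : p ≤ n + 1) :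
    erlang n (Iic x) ≤ ENNReal.ofReal (x ^ p) := by
  rcases le_total x 1 with h1 | h1
  · refine (erlang_Iic_le n hx).trans (ENNReal.ofReal_le_ofReal ?_)
    rw [← Real.rpow_natCast]
    rcases hx.eq_or_lt with rfl | hx
    · rw [Real.zero_rpow (by positivity)]
      positivity
    · exact Real.rpow_le_rpow_of_exponent_ge hx h1 (by simpa using hp)
  · refine prob_le_one.trans ?_
    rw [ENNReal.one_le_ofReal]
    exact Real.one_le_rpow h1 hp0

lemma erlang_real_Iic (n : ℕ) {x : ℝ} (hx : 0 ≤ x) :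
    (erlang n).real (Iic x) = ∫ y in (0 : ℝ)..x, erlangPDF n y := by
  rw [measureReal_def, erlang_Iic_eq_Ioc, erlang_apply n measurableSet_Ioc,
    inter_eq_left.2 (fun y hy => hy.1), intervalIntegral.integral_of_le hx,
    integral_eq_lintegral_of_nonneg_ae _ (by fun_prop)]
  exact (ae_restrict_mem measurableSet_Ioc).mono fun y hy => erlangPDF_nonneg n (le_of_lt hy.1)

/-- Replacing `exp (-y)` by `1` in the density costs at most `y ^ (n + 1)`, because `1 - exp (-y) ≤
y`. -/
lemma abs_erlang_real_Iic_sub_le (n : ℕ) {x : ℝ} (hx : 0 ≤ x) :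
    |(erlang n).real (Iic x) - x ^ (n + 1) / (n + 1)!| ≤ x ^ (n + 2) := by
  have h1 : x ^ (n + 1) / (n + 1)! = ∫ y in (0 : ℝ)..x, y ^ n / n ! := by
    rw [intervalIntegral.integral_div, integral_pow, Nat.factorial_succ]
    push_cast
    have : (n ! : ℝ) ≠ 0 := by positivity
    field_simp
    simp
  have h2 : x ^ (n + 2) = ∫ y in (0 : ℝ)..x, x ^ (n + 1) := by
    rw [intervalIntegral.integral_const]
    simp
    ring
  have hi1 : IntervalIntegrable (erlangPDF n) volume 0 x :=
    (continuous_erlangPDF n).intervalIntegrable _ _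
  have hi2 : IntervalIntegrable (fun y : ℝ => y ^ n / n !) volume 0 x :=
    (by fun_prop : Continuous fun y : ℝ => y ^ n / n !).intervalIntegrable _ _
  rw [erlang_real_Iic n hx, h1, h2, ← intervalIntegral.integral_sub hi1 hi2]
  refine (intervalIntegral.abs_integral_le_integral_abs hx).trans ?_
  refine intervalIntegral.integral_mono_on hx (hi1.sub hi2).abs (by simp) fun y hy => ?_
  rw [abs_sub_comm, abs_of_nonneg (sub_nonneg.2 (erlangPDF_le_pow_div n hy.1))]
  have h3 : 1 - y ≤ Real.exp (-y) := by linarith [Real.add_one_le_exp (-y)]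
  have h4 := pow_div_factorial_le n hy.1
  have h5 : (0 : ℝ) ≤ y ^ n / n ! := div_nonneg (pow_nonneg hy.1 n) (by positivity)
  calc y ^ n / (n !) - erlangPDF n y = y ^ n / (n !) * (1 - Real.exp (-y)) := by
        unfold erlangPDF; ring
    _ ≤ y ^ n * y := mul_le_mul h4 (by linarith)
        (by linarith [Real.exp_le_one_iff.2 (by linarith [hy.1] : -y ≤ 0)]) (pow_nonneg hy.1 n)
    _ = y ^ (n + 1) := (pow_succ y n).symm
    _ ≤ x ^ (n + 1) := pow_le_pow_left₀ hy.1 hy.2 _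

lemma setLIntegral_erlang (n : ℕ) {s : Set ℝ} (hs : MeasurableSet s) {g : ℝ → ℝ}
    (hg : Measurable g) :
    ∫⁻ y in s, ENNReal.ofReal (g y) ∂erlang n =
      ∫⁻ y in s ∩ Ioi 0, ENNReal.ofReal (erlangPDF n y * g y) := by
  rw [erlang, restrict_withDensity hs, lintegral_withDensity_eq_lintegral_mul _ (by fun_prop)
    (by fun_prop), Measure.restrict_restrict hs]
  refine setLIntegral_congr_fun (by measurability) fun y hy => ?_
  simp only [Pi.mul_apply]
  rw [← ENNReal.ofReal_mul (erlangPDF_nonneg n (le_of_lt hy.2))]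

/-- The truncated negative moment of the Gamma distribution of shape `n + 1` that controls the
joint deep fades of the two hops. -/
def truncatedNegMoment (n : ℕ) (b : ℝ) : ℝ≥0∞ :=
  ∫⁻ y in Ioi b, ENNReal.ofReal (1 / y + y ^ (-((n : ℝ) + 2) / 2)) ∂erlang n

/-- Against the factor `y ^ n` of the density the two terms have exponents `n - 1` and `n / 2 - 1`,
both above `-1` when `n ≥ 1`; no truncation is needed. -/
lemma truncatedNegMoment_le_of_pos {n : ℕ} (hn : 1 ≤ n) :
    ∃ K : ℝ, 0 ≤ K ∧ ∀ b, truncatedNegMoment n b ≤ ENNReal.ofReal K := by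
  have hn' : (1 : ℝ) ≤ n := by exact_mod_cast hn
  have hI : IntegrableOn
      (fun y : ℝ => erlangPDF n y * (1 / y + y ^ (-((n : ℝ) + 2) / 2))) (Ioi 0) := by
    have i1 := integrableOn_rpow_mul_exp_neg_mul_rpow (p := 1) (s := (n : ℝ) - 1) (b := 1)
      (by linarith) one_pos one_pos
    have i2 := integrableOn_rpow_mul_exp_neg_mul_rpow (p := 1) (s := (n : ℝ) / 2 - 1) (b := 1)
      (by linarith) one_pos one_pos
    refine IntegrableOn.congr_fun ((i1.add i2).const_mul ((n ! : ℝ)⁻¹)) (fun y hy => ?_) measurableSet_Ioi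
    have hy : 0 < y := hy
    have e1 : y ^ ((n : ℝ) - 1) = y ^ n * (1 / y) := by
      rw [Real.rpow_sub hy, Real.rpow_natCast, Real.rpow_one]
      ring
    have e2 : y ^ ((n : ℝ) / 2 - 1) = y ^ n * y ^ (-((n : ℝ) + 2) / 2) := by
      rw [← Real.rpow_natCast, ← Real.rpow_add hy]
      congr 1
      ring
    simp only [Pi.add_apply, e1, e2, Real.rpow_one, erlangPDF]
    ring_nf
  refine ⟨∫ y in Ioi 0, erlangPDF n y * (1 / y + y ^ (-((n : ℝ) + 2) / 2)),
    setIntegral_nonneg measurableSet_Ioi fun y hy => ?_, fun b => ?_⟩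
  · have hy : 0 < y := hy
    have := erlangPDF_nonneg n hy.le
    positivity
  · rw [truncatedNegMoment, setLIntegral_erlang n measurableSet_Ioi (by fun_prop),
      ofReal_integral_eq_lintegral_ofReal hI]
    · exact lintegral_mono_set inter_subset_right
    · refine (ae_restrict_mem measurableSet_Ioi).mono fun y hy => ?_
      have hy : 0 < y := hy
      have := erlangPDF_nonneg n hy.le
      simp only [Pi.zero_apply]
      positivity

/-- For `n = 0` both terms equal `1 / y`, and the integral diverges logarithmically at the origin.
-/
lemma truncatedNegMoment_zero_le {b : ℝ} (hb : 0 < b) (hb1 : b ≤ 1) :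
    truncatedNegMoment 0 b ≤ ENNReal.ofReal (2 * Real.log (1 / b) + 2) := by
  have hpt : ∀ y : ℝ, 0 < y →
      erlangPDF 0 y * (1 / y + y ^ (-(((0 : ℕ) : ℝ) + 2) / 2)) = 2 * (y⁻¹ * Real.exp (-y)) := by
    intro y hy
    have : (-(((0 : ℕ) : ℝ) + 2) / 2) = -1 := by norm_num
    rw [this, Real.rpow_neg_one, erlangPDF]
    simp
    ring
  have hi1 : IntegrableOn (fun y : ℝ => 2 * y⁻¹) (Ioc b 1) := by
    have : ContinuousOn (fun y : ℝ => 2 * y⁻¹) (Icc b 1) := by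
      refine continuousOn_const.mul (continuousOn_id.inv₀ fun y hy => ?_)
      exact (lt_of_lt_of_le hb hy.1).ne'
    exact (this.integrableOn_Icc).mono_set Ioc_subset_Icc_self
  have hi2 : IntegrableOn (fun y : ℝ => 2 * Real.exp (-y)) (Ioi 0) :=
    (integrableOn_exp_neg_Ioi 0).const_mul 2
  rw [truncatedNegMoment, setLIntegral_erlang 0 measurableSet_Ioi (by fun_prop)]
  calc ∫⁻ y in Ioi b ∩ Ioi 0,
        ENNReal.ofReal (erlangPDF 0 y * (1 / y + y ^ (-(((0 : ℕ) : ℝ) + 2) / 2)))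
      = ∫⁻ y in Ioi b, ENNReal.ofReal (2 * (y⁻¹ * Real.exp (-y))) := by
        rw [inter_eq_left.2 (Ioi_subset_Ioi hb.le)]
        exact setLIntegral_congr_fun measurableSet_Ioi fun y hy => by
          rw [hpt y (hb.trans hy)]
    -- Below `1` the exponential is dropped, above `1` the factor `y⁻¹`.
    _ ≤ (∫⁻ y in Ioc b 1, ENNReal.ofReal (2 * (y⁻¹ * Real.exp (-y)))) +
          ∫⁻ y in Ioi 1, ENNReal.ofReal (2 * (y⁻¹ * Real.exp (-y))) := by
        rw [← Ioc_union_Ioi_eq_Ioi hb1]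
        exact lintegral_union_le _ _ _
    _ ≤ (∫⁻ y in Ioc b 1, ENNReal.ofReal (2 * y⁻¹)) +
          ∫⁻ y in Ioi 0, ENNReal.ofReal (2 * Real.exp (-y)) := by
        refine add_le_add ?_ ?_
        · refine setLIntegral_mono' measurableSet_Ioc fun y hy => ENNReal.ofReal_le_ofReal ?_
          have hy0 : 0 < y := hb.trans hy.1
          have : Real.exp (-y) ≤ 1 := Real.exp_le_one_iff.2 (by linarith)
          have : y⁻¹ * Real.exp (-y) ≤ y⁻¹ := mul_le_of_le_one_right (by positivity) this
          linarith
        · refine (setLIntegral_mono' measurableSet_Ioi fun y hy => ENNReal.ofReal_le_ofReal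
            (q := 2 * Real.exp (-y)) ?_).trans
            (lintegral_mono_set (Ioi_subset_Ioi zero_le_one))
          have hy1 : (1 : ℝ) < y := hy
          have : y⁻¹ ≤ 1 := inv_le_one_of_one_le₀ hy1.le
          have : y⁻¹ * Real.exp (-y) ≤ Real.exp (-y) :=
            mul_le_of_le_one_left (Real.exp_pos _).le this
          linarith
    _ = ENNReal.ofReal (2 * Real.log (1 / b)) + ENNReal.ofReal 2 := by
        rw [← ofReal_integral_eq_lintegral_ofReal hi1, ← ofReal_integral_eq_lintegral_ofReal hi2,
          ← intervalIntegral.integral_of_le hb1, intervalIntegral.integral_const_mul,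
          integral_inv_of_pos hb one_pos, integral_const_mul, integral_exp_neg_Ioi_zero, mul_one]
        · exact ae_of_all _ fun y => by simp only [Pi.zero_apply]; positivity
        · refine (ae_restrict_mem measurableSet_Ioc).mono fun y hy => ?_
          have hy0 : 0 < y := hb.trans hy.1
          simp only [Pi.zero_apply]
          positivity
    _ = ENNReal.ofReal (2 * Real.log (1 / b) + 2) := by
        rw [← ENNReal.ofReal_add _ (by norm_num)]
        have : 0 ≤ Real.log (1 / b) := Real.log_nonneg ((one_le_div hb).2 hb1)
        positivity

end Gamma


/-! ### Outage of two independent hops. -/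

section TwoHop

open Set
open scoped ENNReal

lemma lintegral_pow_eq_ofReal {ζ : Measure ℝ} (h1 : ∀ᵐ u ∂ζ, 1 ≤ u) {k : ℕ}
    (hk : Integrable (fun u => u ^ k) ζ) :
    ∫⁻ u, ENNReal.ofReal (u ^ k) ∂ζ = ENNReal.ofReal (∫ u, u ^ k ∂ζ) := by
  rw [ofReal_integral_eq_lintegral_ofReal hk]
  filter_upwards [h1] with u hu
  simp only [Pi.zero_apply]
  positivity

lemma integral_pow_nonneg_of_one_le {ζ : Measure ℝ} (h1 : ∀ᵐ u ∂ζ, 1 ≤ u) (k : ℕ) :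
    0 ≤ ∫ u, u ^ k ∂ζ := by
  refine integral_nonneg_of_ae ?_
  filter_upwards [h1] with u hu
  simp only [Pi.zero_apply]
  positivity

/-- The minimum keeps the interval below `2 a`, which bounds the density by `(2 a) ^ n`, while its
length is at most `r`. -/
lemma erlang_Ioc_add_min_le (n : ℕ) {a r : ℝ} (ha : 0 ≤ a) (hr : 0 ≤ r) :
    erlang n (Ioc a (a + min a r)) ≤ ENNReal.ofReal ((2 * a) ^ n * r) := by
  have h0 : 0 ≤ min a r := le_min ha hr
  refine (erlang_Ioc_le n (by linarith)).trans (ENNReal.ofReal_le_ofReal ?_)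
  refine mul_le_mul (pow_le_pow_left₀ (by linarith) ?_ n) ?_ ?_ (by positivity)
  · linarith [min_le_left a r]
  · linarith [min_le_right a r]
  · linarith

/-- Both hops are slightly above their outage levels although the end-to-end link is in outage,
the second hop being away from its outage level. -/
lemma measure_second_hop_good_le (n : ℕ) {ζ : Measure ℝ} [IsProbabilityMeasure ζ]
    (h1 : ∀ᵐ u ∂ζ, 1 ≤ u) (hm : Integrable (fun u => u ^ (n + 1)) ζ) {k ε b : ℝ}
    (hk : 0 < k) (hε : 0 < ε) (hb : 0 < b) :
    ((erlang n).prod ((erlang n).prod ζ))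
        {q | 2 * b < q.2.1 ∧ ε * q.2.2 < q.1 ∧
          (q.1 - ε * q.2.2) * (q.2.1 - b) < k * ε ^ 2 * q.2.2} ≤
      ENNReal.ofReal (((4 * k) ^ (((n : ℝ) + 2) / 2) + 2 ^ (n + 1) * k) * ε ^ (n + 2)) *
        (truncatedNegMoment n (2 * b) * ENNReal.ofReal (∫ u, u ^ (n + 1) ∂ζ)) := by
  -- This exponent turns `ε ^ 2` into `ε ^ (n + 2)`, while `y ^ n * y ^ (-p)` stays integrable at
  -- `0` for `n ≥ 1`.
  set p : ℝ := ((n : ℝ) + 2) / 2 with hp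
  set K : ℝ := (4 * k) ^ p + 2 ^ (n + 1) * k with hK
  have hK0 : 0 ≤ K := by positivity
  have hn0 : (0 : ℝ) ≤ n := by positivity
  have hmeas : MeasurableSet {q : ℝ × ℝ × ℝ | 2 * b < q.2.1 ∧ ε * q.2.2 < q.1 ∧
      (q.1 - ε * q.2.2) * (q.2.1 - b) < k * ε ^ 2 * q.2.2} := by
    measurability
  have hsec : ∀ᵐ r : ℝ × ℝ ∂((erlang n).prod ζ),
      erlang n ((fun x => (x, r)) ⁻¹' {q : ℝ × ℝ × ℝ | 2 * b < q.2.1 ∧ ε * q.2.2 < q.1 ∧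
        (q.1 - ε * q.2.2) * (q.2.1 - b) < k * ε ^ 2 * q.2.2}) ≤
      ENNReal.ofReal (K * ε ^ (n + 2)) *
        ((Ioi (2 * b)).indicator (fun y => ENNReal.ofReal (1 / y + y ^ (-((n : ℝ) + 2) / 2))) r.1 *
          ENNReal.ofReal (r.2 ^ (n + 1))) := by
    filter_upwards [Measure.quasiMeasurePreserving_snd.ae h1] with r hu
    obtain ⟨y, u⟩ := r
    simp only at hu ⊢
    by_cases hy : 2 * b < y
    swap
    · have : ((fun x => (x, (y, u))) ⁻¹' {q : ℝ × ℝ × ℝ | 2 * b < q.2.1 ∧ ε * q.2.2 < q.1 ∧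
        (q.1 - ε * q.2.2) * (q.2.1 - b) < k * ε ^ 2 * q.2.2}) = ∅ := by
        ext x
        simp [hy]
      rw [this, measure_empty]
      exact zero_le
    have hy0 : 0 < y := by linarith
    have hu0 : 0 < u := by linarith
    rw [indicator_of_mem (show y ∈ Ioi (2 * b) from hy)]
    -- Since `y - b > y / 2`, the excess `x - ε u` is below `2 k ε² u / y`. If moreover `x > 2 ε u`,
    -- the excess is more than `x / 2`, which bounds `x` itself.
    have hsub : ((fun x => (x, (y, u))) ⁻¹' {q : ℝ × ℝ × ℝ | 2 * b < q.2.1 ∧ ε * q.2.2 < q.1 ∧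
        (q.1 - ε * q.2.2) * (q.2.1 - b) < k * ε ^ 2 * q.2.2}) ⊆
        Iic (4 * k * ε ^ 2 * u / y) ∪
          Ioc (ε * u) (ε * u + min (ε * u) (2 * k * ε ^ 2 * u / y)) := by
      rintro x ⟨-, hx, hlt⟩
      simp only at hx hlt
      rcases le_or_gt x (2 * (ε * u)) with hle | hgt
      · right
        refine ⟨hx, ?_⟩
        rw [← sub_le_iff_le_add', le_min_iff]
        refine ⟨by linarith, ?_⟩
        rw [le_div_iff₀ hy0]
        nlinarith
      · left
        rw [mem_Iic, le_div_iff₀ hy0]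
        nlinarith [mul_nonneg (sub_nonneg.2 hgt.le) hy0.le,
          mul_nonneg (sub_nonneg.2 hx.le) (sub_nonneg.2 hy.le)]
    refine (measure_mono hsub).trans ((measure_union_le _ _).trans ?_)
    have e1 := erlang_Iic_le_rpow n (x := 4 * k * ε ^ 2 * u / y) (p := p) (by positivity)
      (by positivity) (by rw [hp]; linarith)
    have e2 := erlang_Ioc_add_min_le n (a := ε * u) (r := 2 * k * ε ^ 2 * u / y) (by positivity)
      (by positivity)
    refine (add_le_add e1 e2).trans ?_
    rw [← ENNReal.ofReal_add (by positivity) (by positivity),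
      ← ENNReal.ofReal_mul (by positivity), ← ENNReal.ofReal_mul (by positivity)]
    refine ENNReal.ofReal_le_ofReal ?_
    have r1 : (4 * k * ε ^ 2 * u / y) ^ p = (4 * k) ^ p * ε ^ (n + 2) * u ^ p * y ^ (-p) := by
      rw [Real.div_rpow (by positivity) hy0.le, Real.mul_rpow (by positivity) hu0.le,
        Real.mul_rpow (by positivity) (by positivity), ← Real.rpow_natCast ε 2,
        ← Real.rpow_mul hε.le, Real.rpow_neg hy0.le, ← Real.rpow_natCast ε (n + 2)]
      have : ((2 : ℕ) : ℝ) * p = ((n + 2 : ℕ) : ℝ) := by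
        rw [hp]
        push_cast
        ring
      rw [this, div_eq_mul_inv]
    have r2 : u ^ p ≤ u ^ (n + 1) := by
      rw [← Real.rpow_natCast]
      refine Real.rpow_le_rpow_of_exponent_le hu ?_
      push_cast
      rw [hp]
      linarith
    have r3 : (2 * (ε * u)) ^ n * (2 * k * ε ^ 2 * u / y) =
        2 ^ (n + 1) * k * ε ^ (n + 2) * u ^ (n + 1) * (1 / y) := by
      ring
    have r4 : -((n : ℝ) + 2) / 2 = -p := by rw [hp]; ring
    rw [r1, r3, r4]
    have hyp : 0 ≤ y ^ (-p) := by positivity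
    have hA : 0 ≤ (4 * k) ^ p := by positivity
    have hB : 0 ≤ 2 ^ (n + 1) * k := by positivity
    have hE : 0 ≤ ε ^ (n + 2) := by positivity
    have hU : 0 ≤ u ^ (n + 1) := by positivity
    have hY : 0 ≤ 1 / y := by positivity
    have s1 : (4 * k) ^ p * ε ^ (n + 2) * u ^ p * y ^ (-p) ≤
        (4 * k) ^ p * ε ^ (n + 2) * u ^ (n + 1) * y ^ (-p) := by gcongr
    -- Adding the nonnegative cross terms makes the bound factor as a constant times the integrand
    -- of `truncatedNegMoment`.
    have s2 : 0 ≤ (4 * k) ^ p * ε ^ (n + 2) * u ^ (n + 1) * (1 / y) := by positivity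
    have s3 : 0 ≤ 2 ^ (n + 1) * k * ε ^ (n + 2) * u ^ (n + 1) * y ^ (-p) := by positivity
    calc _ ≤ _ := add_le_add_left s1 _
      _ ≤ (4 * k) ^ p * ε ^ (n + 2) * u ^ (n + 1) * y ^ (-p) +
            2 ^ (n + 1) * k * ε ^ (n + 2) * u ^ (n + 1) * (1 / y) +
            ((4 * k) ^ p * ε ^ (n + 2) * u ^ (n + 1) * (1 / y) +
            2 ^ (n + 1) * k * ε ^ (n + 2) * u ^ (n + 1) * y ^ (-p)) := by linarith
      _ = _ := by rw [hK]; ring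
  rw [Measure.prod_apply_symm hmeas]
  refine (lintegral_mono_ae hsec).trans (le_of_eq ?_)
  have hmi : Measurable ((Ioi (2 * b)).indicator
      (fun y : ℝ => ENNReal.ofReal (1 / y + y ^ (-((n : ℝ) + 2) / 2)))) :=
    Measurable.indicator (by fun_prop) measurableSet_Ioi
  have hprod := lintegral_prod_mul (μ := erlang n) (ν := ζ) hmi.aemeasurable
    (g := fun u => ENNReal.ofReal (u ^ (n + 1))) (by fun_prop)
  rw [lintegral_const_mul' _ _ ENNReal.ofReal_ne_top, hprod,
    lintegral_indicator measurableSet_Ioi, lintegral_pow_eq_ofReal h1 hm]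
  rfl

/-- The counterpart of `measure_second_hop_good_le` with the roles of the hops exchanged. -/
lemma measure_first_hop_good_le (n : ℕ) {ζ : Measure ℝ} [IsProbabilityMeasure ζ]
    (h1 : ∀ᵐ u ∂ζ, 1 ≤ u) (hm : Integrable (fun u => u ^ (n + 1)) ζ) {k ε μ : ℝ}
    (hk : 0 < k) (hε : 0 < ε) (hμ : 0 < μ) :
    ((erlang n).prod ((erlang n).prod ζ))
        {q | 2 * (ε * q.2.2) < q.1 ∧ ε / μ < q.2.1 ∧ q.2.1 ≤ 2 * (ε / μ) ∧
          (q.1 - ε * q.2.2) * (q.2.1 - ε / μ) < k * ε ^ 2 * q.2.2} ≤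
      ENNReal.ofReal ((2 / μ) ^ n * (2 * k) * ε ^ (n + 2)) *
        (truncatedNegMoment n (2 * ε) * ENNReal.ofReal (∫ u, u ^ (n + 1) ∂ζ)) := by
  set b := ε / μ with hb
  have hb0 : 0 < b := by positivity
  set S : Set (ℝ × ℝ × ℝ) := {q | 2 * (ε * q.2.2) < q.1 ∧ b < q.2.1 ∧ q.2.1 ≤ 2 * b ∧
          (q.1 - ε * q.2.2) * (q.2.1 - b) < k * ε ^ 2 * q.2.2} with hS
  have hmeas : MeasurableSet S := by
    measurability
  set g : ℝ → ℝ≥0∞ :=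
    (Ioi (2 * ε)).indicator (fun y => ENNReal.ofReal (1 / y + y ^ (-((n : ℝ) + 2) / 2))) with hg
  have hmi : Measurable g := Measurable.indicator (by fun_prop) measurableSet_Ioi
  have hsec : ∀ x, ∀ᵐ u ∂ζ, erlang n ((fun y => (y, u)) ⁻¹' (Prod.mk x ⁻¹' S)) ≤
      ENNReal.ofReal ((2 / μ) ^ n * (2 * k) * ε ^ (n + 2)) *
        (g x * ENNReal.ofReal (u ^ (n + 1))) := by
    intro x
    filter_upwards [h1] with u hu
    have hu0 : 0 < u := by linarith
    by_cases hx : 2 * (ε * u) < x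
    swap
    · have : ((fun y => (y, u)) ⁻¹' (Prod.mk x ⁻¹' S)) = ∅ := by
        ext y
        simp [hS, hx]
      rw [this, measure_empty]
      exact zero_le
    -- As `u ≥ 1`, the truncation level can be made independent of `u`.
    have hx1 : 2 * ε < x := by nlinarith
    have hx0 : 0 < x := by linarith
    rw [hg, indicator_of_mem (show x ∈ Ioi (2 * ε) from hx1)]
    have hsub : ((fun y => (y, u)) ⁻¹' (Prod.mk x ⁻¹' S)) ⊆
        Ioc b (b + min b (2 * k * ε ^ 2 * u / x)) := by
      rintro y ⟨-, hy1, hy2, hlt⟩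
      simp only at hy1 hy2 hlt
      refine ⟨hy1, ?_⟩
      rw [← sub_le_iff_le_add', le_min_iff]
      refine ⟨by linarith, ?_⟩
      rw [le_div_iff₀ hx0]
      nlinarith
    refine (measure_mono hsub).trans ((erlang_Ioc_add_min_le n hb0.le (by positivity)).trans ?_)
    rw [← ENNReal.ofReal_mul (by positivity), ← ENNReal.ofReal_mul (by positivity)]
    refine ENNReal.ofReal_le_ofReal ?_
    have hxp : 0 ≤ x ^ (-((n : ℝ) + 2) / 2) := by positivity
    have r2 : u ≤ u ^ (n + 1) := le_self_pow₀ hu (by omega)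
    calc (2 * b) ^ n * (2 * k * ε ^ 2 * u / x)
        = (2 / μ) ^ n * (2 * k) * ε ^ (n + 2) * (1 / x * u) := by
          rw [hb]
          ring
      -- Only `1 / x` is needed; the other power is added to reuse the same truncated moment.
      _ ≤ (2 / μ) ^ n * (2 * k) * ε ^ (n + 2) *
            ((1 / x + x ^ (-((n : ℝ) + 2) / 2)) * u ^ (n + 1)) := by
          gcongr
          linarith
  rw [Measure.prod_apply hmeas]
  calc ∫⁻ x, ((erlang n).prod ζ) (Prod.mk x ⁻¹' S) ∂erlang n
      ≤ ∫⁻ x, ENNReal.ofReal ((2 / μ) ^ n * (2 * k) * ε ^ (n + 2)) *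
        (g x * ENNReal.ofReal (∫ u, u ^ (n + 1) ∂ζ)) ∂erlang n := by
        refine lintegral_mono fun x => ?_
        simp only
        rw [Measure.prod_apply_symm (measurable_prodMk_left hmeas)]
        refine (lintegral_mono_ae (hsec x)).trans (le_of_eq ?_)
        rw [lintegral_const_mul _ (by fun_prop), lintegral_const_mul _ (by fun_prop),
          lintegral_pow_eq_ofReal h1 hm]
    _ = _ := by
        rw [lintegral_const_mul _ (by fun_prop), lintegral_mul_const _ hmi, hg,
          lintegral_indicator measurableSet_Ioi]
        rfl

/-- Both hops are close to their outage levels. -/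
lemma measure_both_hops_bad_le (n : ℕ) {ζ : Measure ℝ} [IsProbabilityMeasure ζ]
    (h1 : ∀ᵐ u ∂ζ, 1 ≤ u) (hm : Integrable (fun u => u ^ (n + 1)) ζ) {ε μ : ℝ}
    (hε : 0 < ε) (hε1 : ε ≤ 1) (hμ : 0 < μ) :
    ((erlang n).prod ((erlang n).prod ζ))
        {q | q.1 ≤ 2 * (ε * q.2.2) ∧ q.2.1 ≤ 2 * (ε / μ)} ≤
      ENNReal.ofReal ((4 / μ) ^ (n + 1) * ε ^ (n + 2)) *
        ENNReal.ofReal (∫ u, u ^ (n + 1) ∂ζ) := by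
  have hmeas : MeasurableSet {q : ℝ × ℝ × ℝ | q.1 ≤ 2 * (ε * q.2.2) ∧ q.2.1 ≤ 2 * (ε / μ)} := by
    measurability
  have hsec : ∀ᵐ r : ℝ × ℝ ∂((erlang n).prod ζ),
      erlang n ((fun x => (x, r)) ⁻¹'
        {q : ℝ × ℝ × ℝ | q.1 ≤ 2 * (ε * q.2.2) ∧ q.2.1 ≤ 2 * (ε / μ)}) ≤
      (Iic (2 * (ε / μ))).indicator (fun _ => ENNReal.ofReal ((2 * ε) ^ (n + 1))) r.1 *
        ENNReal.ofReal (r.2 ^ (n + 1)) := by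
    filter_upwards [Measure.quasiMeasurePreserving_snd.ae h1] with r hu
    obtain ⟨y, u⟩ := r
    simp only at hu ⊢
    have hu0 : 0 < u := by linarith
    by_cases hy : y ≤ 2 * (ε / μ)
    · rw [indicator_of_mem (show y ∈ Iic (2 * (ε / μ)) from hy), ← ENNReal.ofReal_mul (by positivity),
        ← mul_pow]
      refine (measure_mono (t := Iic (2 * (ε * u))) fun x hx => hx.1).trans
        ((erlang_Iic_le n (by positivity)).trans (le_of_eq ?_))
      ring_nf
    · have : ((fun x => (x, (y, u))) ⁻¹'
          {q : ℝ × ℝ × ℝ | q.1 ≤ 2 * (ε * q.2.2) ∧ q.2.1 ≤ 2 * (ε / μ)}) = ∅ := by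
        ext x
        simp [hy]
      rw [this, measure_empty]
      exact zero_le
  rw [Measure.prod_apply_symm hmeas]
  refine (lintegral_mono_ae hsec).trans ?_
  have hmi : Measurable ((Iic (2 * (ε / μ))).indicator
      (fun _ : ℝ => ENNReal.ofReal ((2 * ε) ^ (n + 1)))) :=
    Measurable.indicator (by fun_prop) measurableSet_Iic
  have hprod := lintegral_prod_mul (μ := erlang n) (ν := ζ) hmi.aemeasurable
    (g := fun u => ENNReal.ofReal (u ^ (n + 1))) (by fun_prop)
  rw [hprod, lintegral_pow_eq_ofReal h1 hm,
    lintegral_indicator measurableSet_Iic, setLIntegral_const]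
  refine mul_le_mul_left ?_ _
  refine (mul_le_mul_right (erlang_Iic_le n (by positivity)) _).trans ?_
  rw [← ENNReal.ofReal_mul (by positivity)]
  refine ENNReal.ofReal_le_ofReal ?_
  -- Independence gives the order `2 n + 2`, which is at least `n + 2`.
  calc (2 * ε) ^ (n + 1) * (2 * (ε / μ)) ^ (n + 1)
      = (4 / μ) ^ (n + 1) * ε ^ (n + 2 + n) := by
        rw [← mul_pow]
        have : 2 * ε * (2 * (ε / μ)) = 4 / μ * ε ^ 2 := by ring
        rw [this, mul_pow, ← pow_mul]
        ring_nf
    _ ≤ (4 / μ) ^ (n + 1) * ε ^ (n + 2) := by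
        gcongr ?_ * ?_
        exact pow_le_pow_of_le_one hε.le hε1 (by omega)

/-- Condition on `u` and expand the Gamma distribution function at `ε u`; the error `(ε u) ^ (n +
2)` is paid for by the moment of order `n + 2`. -/
lemma abs_first_hop_outage_sub_le (n : ℕ) {ζ : Measure ℝ} [IsProbabilityMeasure ζ]
    (h1 : ∀ᵐ u ∂ζ, 1 ≤ u) (hm : Integrable (fun u => u ^ (n + 1)) ζ)
    (hm' : Integrable (fun u => u ^ (n + 2)) ζ) {ε : ℝ} (hε : 0 < ε) :
    |((erlang n).prod ((erlang n).prod ζ)).real {q | q.1 ≤ ε * q.2.2} -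
        (∫ u, u ^ (n + 1) ∂ζ) * (ε ^ (n + 1) / (n + 1)!)| ≤
      (∫ u, u ^ (n + 2) ∂ζ) * ε ^ (n + 2) := by
  have hmeas : MeasurableSet {q : ℝ × ℝ × ℝ | q.1 ≤ ε * q.2.2} :=
    measurableSet_le (by fun_prop) (by fun_prop)
  have hF : Monotone fun x : ℝ => (erlang n).real (Iic x) := fun x y hxy =>
    measureReal_mono (Iic_subset_Iic.2 hxy)
  have hFm : Measurable fun u : ℝ => (erlang n).real (Iic (ε * u)) :=
    hF.measurable.comp (by fun_prop)
  have hFi : Integrable (fun u : ℝ => (erlang n).real (Iic (ε * u))) ζ :=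
    Integrable.of_bound hFm.aestronglyMeasurable 1
      (ae_of_all _ fun u => by
        rw [Real.norm_of_nonneg measureReal_nonneg]
        exact measureReal_le_one)
  have hA : ((erlang n).prod ((erlang n).prod ζ)).real {q | q.1 ≤ ε * q.2.2} =
      ∫ u, (erlang n).real (Iic (ε * u)) ∂ζ := by
    have hq : ∀ r : ℝ × ℝ, ((fun x => (x, r)) ⁻¹' {q : ℝ × ℝ × ℝ | q.1 ≤ ε * q.2.2}) =
        Iic (ε * r.2) := fun r => rfl
    rw [measureReal_def, Measure.prod_apply_symm hmeas]
    simp only [hq]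
    have hEm : Measurable fun u : ℝ => erlang n (Iic (ε * u)) :=
      (show Monotone fun x : ℝ => erlang n (Iic x) from fun x y hxy =>
        measure_mono (Iic_subset_Iic.2 hxy)).measurable.comp (by fun_prop)
    rw [lintegral_prod (fun r : ℝ × ℝ => erlang n (Iic (ε * r.2)))
      (hEm.comp measurable_snd).aemeasurable]
    simp only [lintegral_const, measure_univ, mul_one]
    rw [integral_eq_lintegral_of_nonneg_ae (ae_of_all _ fun u => measureReal_nonneg)
      hFm.aestronglyMeasurable]
    congr 1
    refine lintegral_congr fun u => ?_
    rw [measureReal_def, ENNReal.ofReal_toReal (measure_ne_top _ _)]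
  have hL : (∫ u, u ^ (n + 1) ∂ζ) * (ε ^ (n + 1) / (n + 1)!) =
      ∫ u, (ε * u) ^ (n + 1) / (n + 1)! ∂ζ := by
    rw [← integral_mul_const]
    refine integral_congr_ae (ae_of_all _ fun u => ?_)
    simp only
    rw [mul_pow]
    ring
  have hLi : Integrable (fun u => (ε * u) ^ (n + 1) / ((n + 1)! : ℝ)) ζ := by
    simp only [mul_pow]
    exact (hm.const_mul _).div_const _
  rw [hA, hL, ← integral_sub hFi hLi, ← integral_mul_const]
  refine abs_integral_le_integral_abs.trans ?_
  refine integral_mono_ae (hFi.sub hLi).abs (hm'.mul_const _) ?_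
  filter_upwards [h1] with u hu
  refine (abs_erlang_real_Iic_sub_le n (x := ε * u) (by nlinarith)).trans (le_of_eq ?_)
  rw [mul_pow, mul_comm]

lemma abs_second_hop_outage_sub_le (n : ℕ) {ζ : Measure ℝ} [IsProbabilityMeasure ζ] {b : ℝ}
    (hb : 0 < b) :
    |((erlang n).prod ((erlang n).prod ζ)).real {q | q.2.1 ≤ b} - b ^ (n + 1) / (n + 1)!| ≤
      b ^ (n + 2) := by
  have : ((erlang n).prod ((erlang n).prod ζ)).real {q | q.2.1 ≤ b} = (erlang n).real (Iic b) := by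
    have : {q : ℝ × ℝ × ℝ | q.2.1 ≤ b} = univ ×ˢ (Iic b ×ˢ univ) := by
      ext q
      simp
    rw [this, measureReal_prod_prod, measureReal_prod_prod]
    simp
  rw [this]
  exact abs_erlang_real_Iic_sub_le n hb.le

/-- High-SNR expansion of the outage probability of two hops with Erlang-distributed gains. -/
lemma abs_two_hop_outage_sub_le (n : ℕ) {ζ : Measure ℝ} [IsProbabilityMeasure ζ]
    (h1 : ∀ᵐ u ∂ζ, 1 ≤ u) (hm : Integrable (fun u => u ^ (n + 1)) ζ)
    (hm' : Integrable (fun u => u ^ (n + 2)) ζ) {μ k : ℝ} (hμ : 0 < μ) (hk : 1 / μ < k) :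
    ∃ K : ℝ, 0 ≤ K ∧ ∀ ε : ℝ, 0 < ε → ε ≤ 1 → ∀ Λ : ℝ, 0 ≤ Λ →
      truncatedNegMoment n (2 * (ε / μ)) ≤ ENNReal.ofReal Λ →
      truncatedNegMoment n (2 * ε) ≤ ENNReal.ofReal Λ →
      |((erlang n).prod ((erlang n).prod ζ)).real
          {q | (q.1 - ε * q.2.2) * (q.2.1 - ε / μ) < k * ε ^ 2 * q.2.2} -
        (1 / μ ^ (n + 1) + ∫ u, u ^ (n + 1) ∂ζ) * (ε ^ (n + 1) / (n + 1)!)| ≤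
      K * ε ^ (n + 2) * (1 + Λ) := by
  set m := ∫ u, u ^ (n + 1) ∂ζ with hmdef
  set m' := ∫ u, u ^ (n + 2) ∂ζ with hm'def
  have hm0 : 0 ≤ m := integral_pow_nonneg_of_one_le h1 _
  have hm'0 : 0 ≤ m' := integral_pow_nonneg_of_one_le h1 _
  have hk0 : 0 < k := lt_trans (by positivity) hk
  set K1 := (4 * k) ^ (((n : ℝ) + 2) / 2) + 2 ^ (n + 1) * k with hK1
  set K3 := (2 / μ) ^ n * (2 * k) with hK3
  set K4 := (4 / μ) ^ (n + 1) with hK4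
  have hK1' : 0 ≤ K1 := by positivity
  have hK3' : 0 ≤ K3 := by positivity
  have hK4' : 0 ≤ K4 := by positivity
  -- The first three terms pay for `D₁`, `D₂`, `D₃`, the last two for the expansions of the two
  -- single-hop failures.
  refine ⟨K1 * m + K3 * m + K4 * m + m' + 1 / μ ^ (n + 2), by positivity,
    fun ε hε hε1 Λ hΛ hT1 hT2 => ?_⟩
  set κ := (erlang n).prod ((erlang n).prod ζ) with hκ
  have hb : 0 < ε / μ := by positivity
  set E : Set (ℝ × ℝ × ℝ) := {q | (q.1 - ε * q.2.2) * (q.2.1 - ε / μ) < k * ε ^ 2 * q.2.2} with hE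
  set A : Set (ℝ × ℝ × ℝ) := {q | q.1 ≤ ε * q.2.2} with hA
  set B : Set (ℝ × ℝ × ℝ) := {q | q.2.1 ≤ ε / μ} with hB
  set D₁ : Set (ℝ × ℝ × ℝ) := {q | 2 * (ε / μ) < q.2.1 ∧ ε * q.2.2 < q.1 ∧
    (q.1 - ε * q.2.2) * (q.2.1 - ε / μ) < k * ε ^ 2 * q.2.2} with hD₁
  set D₂ : Set (ℝ × ℝ × ℝ) := {q | 2 * (ε * q.2.2) < q.1 ∧ ε / μ < q.2.1 ∧
    q.2.1 ≤ 2 * (ε / μ) ∧ (q.1 - ε * q.2.2) * (q.2.1 - ε / μ) < k * ε ^ 2 * q.2.2} with hD₂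
  set D₃ : Set (ℝ × ℝ × ℝ) := {q | q.1 ≤ 2 * (ε * q.2.2) ∧ q.2.1 ≤ 2 * (ε / μ)} with hD₃
  have hBm : MeasurableSet B := measurableSet_le (by fun_prop) (by fun_prop)
  have hpos : ∀ᵐ q ∂κ, 0 < q.1 ∧ 0 < q.2.1 ∧ 1 ≤ q.2.2 := by
    have a1 : ∀ᵐ q ∂κ, 0 < q.1 := Measure.quasiMeasurePreserving_fst.ae (ae_pos_erlang n)
    have a2 : ∀ᵐ q ∂κ, 0 < q.2.1 := Measure.quasiMeasurePreserving_snd.ae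
      (Measure.quasiMeasurePreserving_fst.ae (ae_pos_erlang n))
    have a3 : ∀ᵐ q ∂κ, 1 ≤ q.2.2 := Measure.quasiMeasurePreserving_snd.ae
      (Measure.quasiMeasurePreserving_snd.ae h1)
    filter_upwards [a1, a2, a3] with q h1 h2 h3 using ⟨h1, h2, h3⟩
  have hup : E ⊆ A ∪ B ∪ (D₁ ∪ D₂ ∪ D₃) := by
    intro q hq
    simp only [hA, hB, hD₁, hD₂, hD₃, mem_union, mem_ofPred_eq]
    have hq : (q.1 - ε * q.2.2) * (q.2.1 - ε / μ) < k * ε ^ 2 * q.2.2 := hq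
    by_cases c1 : q.1 ≤ ε * q.2.2
    · tauto
    by_cases c2 : q.2.1 ≤ ε / μ
    · tauto
    by_cases c3 : q.2.1 ≤ 2 * (ε / μ)
    · by_cases c4 : q.1 ≤ 2 * (ε * q.2.2)
      · tauto
      · exact Or.inr (Or.inl (Or.inr ⟨not_le.1 c4, not_le.1 c2, c3, hq⟩))
    · exact Or.inr (Or.inl (Or.inl ⟨not_le.1 c3, not_le.1 c1, hq⟩))
  have hlow : ∀ᵐ q ∂κ, q ∈ A ∪ B → q ∈ E := by
    filter_upwards [hpos] with q ⟨hx, hy, hu⟩ hq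
    simp only [hA, hB, hE, mem_union, mem_ofPred_eq] at hq ⊢
    have hu0 : 0 < q.2.2 := by linarith
    -- When both gains are below their levels the product of the two negative factors can reach
    -- almost this value; `1 / μ < k` keeps such points in outage.
    have hR : ε / μ * (ε * q.2.2) < k * ε ^ 2 * q.2.2 := by
      have : ε / μ * (ε * q.2.2) = 1 / μ * (ε ^ 2 * q.2.2) := by ring
      rw [this, mul_assoc k]
      exact mul_lt_mul_of_pos_right hk (by positivity)
    have hεu : 0 < ε * q.2.2 := by positivity
    have hR0 : 0 < k * ε ^ 2 * q.2.2 := by positivity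
    rcases le_total q.1 (ε * q.2.2) with c1 | c1 <;> rcases le_total q.2.1 (ε / μ) with c2 | c2
    · nlinarith
    · nlinarith [mul_nonneg (sub_nonneg.2 c1) (sub_nonneg.2 c2)]
    · nlinarith [mul_nonneg (sub_nonneg.2 c1) (sub_nonneg.2 c2)]
    · rcases hq with hq | hq
      · nlinarith [mul_nonneg (sub_nonneg.2 c1) (sub_nonneg.2 c2), le_antisymm hq c1]
      · nlinarith [mul_nonneg (sub_nonneg.2 c1) (sub_nonneg.2 c2), le_antisymm hq c2]
  have hAB : A ∩ B ⊆ D₁ ∪ D₂ ∪ D₃ ∪ {q | ¬ (0 < q.1 ∧ 0 < q.2.1 ∧ 1 ≤ q.2.2)} := by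
    rintro q ⟨hqA, hqB⟩
    have hqA : q.1 ≤ ε * q.2.2 := hqA
    have hqB : q.2.1 ≤ ε / μ := hqB
    by_cases hq : 0 < q.1 ∧ 0 < q.2.1 ∧ 1 ≤ q.2.2
    · left; right
      exact ⟨by linarith, by linarith⟩
    · right
      exact hq
  have hD : κ.real (D₁ ∪ D₂ ∪ D₃) ≤ (K1 * m + K3 * m + K4 * m) * ε ^ (n + 2) * (1 + Λ) := by
    have b1 := measure_second_hop_good_le n h1 hm hk0 hε hb
    have b2 := measure_first_hop_good_le n h1 hm hk0 hε hμ
    have b3 := measure_both_hops_bad_le n h1 hm hε hε1 hμ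
    have hE0 : 0 ≤ ε ^ (n + 2) := by positivity
    refine ENNReal.toReal_le_of_le_ofReal (by positivity) ?_
    have b1' : κ D₁ ≤ ENNReal.ofReal (K1 * ε ^ (n + 2) * (Λ * m)) := by
      refine b1.trans ?_
      rw [ENNReal.ofReal_mul (p := K1 * ε ^ (n + 2)) (by positivity), ENNReal.ofReal_mul hΛ]
      gcongr
    have b2' : κ D₂ ≤ ENNReal.ofReal (K3 * ε ^ (n + 2) * (Λ * m)) := by
      refine b2.trans ?_
      rw [ENNReal.ofReal_mul (p := K3 * ε ^ (n + 2)) (by positivity), ENNReal.ofReal_mul hΛ]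
      gcongr
    have b3' : κ D₃ ≤ ENNReal.ofReal (K4 * ε ^ (n + 2) * m) := by
      rwa [ENNReal.ofReal_mul (by positivity)]
    refine (measure_union_le _ _).trans ((add_le_add_left (measure_union_le _ _) _).trans ?_)
    refine (add_le_add (add_le_add b1' b2') b3').trans ?_
    rw [← ENNReal.ofReal_add (by positivity) (by positivity),
      ← ENNReal.ofReal_add (by positivity) (by positivity)]
    refine ENNReal.ofReal_le_ofReal ?_
    have t1 : 0 ≤ K1 * ε ^ (n + 2) * m := by positivity
    have t2 : 0 ≤ K3 * ε ^ (n + 2) * m := by positivity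
    have t3 : 0 ≤ K4 * ε ^ (n + 2) * (Λ * m) := by positivity
    linarith
  have hU : κ.real E ≤ κ.real A + κ.real B + κ.real (D₁ ∪ D₂ ∪ D₃) :=
    (measureReal_mono hup).trans ((measureReal_union_le _ _).trans
      (add_le_add_left (measureReal_union_le _ _) _))
  -- Inclusion-exclusion: the overlap of the two failures lies in `D₃` up to a null set.
  have hLo : κ.real A + κ.real B ≤ κ.real E + κ.real (D₁ ∪ D₂ ∪ D₃) := by
    rw [← measureReal_union_add_inter hBm]
    refine add_le_add ?_ ?_
    · exact ENNReal.toReal_mono (measure_ne_top _ _) (measure_mono_ae hlow)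
    · refine (measureReal_mono hAB).trans ((measureReal_union_le _ _).trans ?_)
      have : κ.real {q | ¬ (0 < q.1 ∧ 0 < q.2.1 ∧ 1 ≤ q.2.2)} = 0 := by
        rw [measureReal_def, ae_iff.1 hpos, ENNReal.toReal_zero]
      rw [this, add_zero]
  have hAe := abs_first_hop_outage_sub_le n h1 hm hm' hε
  have hBe := abs_second_hop_outage_sub_le n (ζ := ζ) hb
  have hbp : (ε / μ) ^ (n + 1) / (n + 1)! = 1 / μ ^ (n + 1) * (ε ^ (n + 1) / (n + 1)!) := by
    rw [div_pow]
    ring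
  have hbp' : (ε / μ) ^ (n + 2) = 1 / μ ^ (n + 2) * ε ^ (n + 2) := by
    rw [div_pow]
    ring
  rw [hbp, hbp'] at hBe
  rw [abs_le] at hAe hBe ⊢
  have hE0 : 0 ≤ ε ^ (n + 2) := by positivity
  have t1 : 0 ≤ m' * ε ^ (n + 2) * Λ := by positivity
  have t2 : 0 ≤ 1 / μ ^ (n + 2) * ε ^ (n + 2) * Λ := by positivity
  obtain ⟨hAe1, hAe2⟩ := hAe
  obtain ⟨hBe1, hBe2⟩ := hBe
  constructor <;> nlinarith

end TwoHop


/-! ### Circular complex Gaussian variables. -/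

section ComplexGaussian

open Complex (I)

lemma measurable_complex_mk : Measurable fun p : ℝ × ℝ => (⟨p.1, p.2⟩ : ℂ) :=
  Complex.measurableEquivRealProd.symm.measurable

instance : IsProbabilityMeasure complexGaussian :=
  Measure.isProbabilityMeasure_map measurable_complex_mk.aemeasurable

/-- Squaring avoids a complex square root, and the square is what real and imaginary part contribute
together. -/
lemma integral_cexp_mul_sq_gaussianReal_sq {z : ℂ} (hz : z.re < 1) :
    (∫ x : ℝ, Complex.exp (z * (x : ℂ) ^ 2) ∂gaussianReal 0 (1 / 2 : ℝ≥0)) ^ 2 = (1 - z)⁻¹ := by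
  have hpi : (0 : ℝ) < Real.pi := Real.pi_pos
  have hpdf : ∀ x : ℝ, gaussianPDFReal 0 (1 / 2 : ℝ≥0) x • Complex.exp (z * (x : ℂ) ^ 2) =
      (((Real.sqrt Real.pi)⁻¹ : ℝ) : ℂ) * Complex.exp (-(1 - z) * (x : ℂ) ^ 2) := by
    intro x
    have : Complex.exp (-(1 - z) * (x : ℂ) ^ 2) =
        Complex.exp (-(x : ℂ) ^ 2) * Complex.exp (z * (x : ℂ) ^ 2) := by
      rw [← Complex.exp_add]
      ring_nf
    rw [this, Complex.real_smul, gaussianPDFReal]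
    push_cast
    simp only [one_div, sub_zero]
    have h2 : (2 * (Real.pi : ℝ) * (2 : ℝ)⁻¹) = Real.pi := by ring
    rw [h2]
    have h3 : (-(x : ℂ) ^ 2 / (2 * (2 : ℂ)⁻¹)) = -(x : ℂ) ^ 2 := by
      norm_num
    simp only [h3]
    ring
  rw [integral_gaussianReal_eq_integral_smul (by norm_num)]
  simp only [hpdf]
  rw [integral_const_mul, mul_pow, integral_gaussian_sq_complex (by simpa using hz),
    ← Complex.ofReal_pow, inv_pow, Real.sq_sqrt hpi.le]
  have : (Real.pi : ℂ) ≠ 0 := by exact_mod_cast hpi.ne'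
  push_cast
  field_simp

/-- The squared modulus of a `CN(0,1)` variable is exponentially distributed. -/
lemma map_norm_sq_complexGaussian :
    complexGaussian.map (fun z => ‖z‖ ^ 2) = erlang 0 := by
  have hm : Measurable fun z : ℂ => ‖z‖ ^ 2 := by fun_prop
  have := Measure.isProbabilityMeasure_map (μ := complexGaussian) hm.aemeasurable
  refine Measure.ext_of_charFun (funext fun t => ?_)
  rw [charFun_erlang, charFun_apply_real, integral_map hm.aemeasurable (by fun_prop),
    complexGaussian, integral_map measurable_complex_mk.aemeasurable (by fun_prop), zero_add,
    pow_one, ← integral_cexp_mul_sq_gaussianReal_sq (z := t * I) (by simp), sq,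
    ← integral_prod_mul]
  refine integral_congr_ae (ae_of_all _ fun p => ?_)
  simp only
  rw [← Complex.exp_add, Complex.sq_norm, Complex.normSq_apply]
  congr 1
  push_cast
  ring

lemma charFun_complexGaussian (w : ℂ) :
    charFun complexGaussian w = Complex.exp (-(‖w‖ ^ 2 / 4 : ℝ)) := by
  have h := fun t => charFun_gaussianReal (μ := 0) (v := (1 / 2 : ℝ≥0)) t
  simp only [charFun_apply_real] at h
  rw [charFun_apply, complexGaussian, integral_map measurable_complex_mk.aemeasurable
    (by fun_prop)]
  have h1 : ∀ p : ℝ × ℝ, Complex.exp (inner ℝ (⟨p.1, p.2⟩ : ℂ) w * I) =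
      Complex.exp (w.re * p.1 * I) * Complex.exp (w.im * p.2 * I) := by
    intro p
    rw [← Complex.exp_add]
    congr 1
    rw [Complex.inner]
    simp
    ring
  simp only [h1]
  rw [integral_prod_mul (fun x : ℝ => Complex.exp (w.re * x * I))
    (fun x : ℝ => Complex.exp (w.im * x * I)), h, h, ← Complex.exp_add, Complex.sq_norm,
    Complex.normSq_apply]
  congr 1
  push_cast
  norm_num
  ring

lemma map_comp_eval_complexGaussian {ι β : Type*} [Fintype ι] [MeasurableSpace β] {f : ℂ → β}
    (hf : Measurable f) (i : ι) :
    (Measure.pi fun _ : ι => complexGaussian).map (fun x => f (x i)) = complexGaussian.map f := by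
  conv_rhs => rw [← (measurePreserving_eval (fun _ : ι => complexGaussian) i).map_eq]
  rw [Measure.map_map hf (measurable_pi_apply i)]
  rfl

/-- A unit linear combination of independent `CN(0,1)` variables is `CN(0,1)`. -/
lemma map_sum_mul_complexGaussian {ι : Type*} [Fintype ι] {c : ι → ℂ}
    (hc : ∑ n, ‖c n‖ ^ 2 = 1) :
    (Measure.pi fun _ : ι => complexGaussian).map (fun x => ∑ n, c n * x n) = complexGaussian := by
  have hm : Measurable fun x : ι → ℂ => ∑ n, c n * x n := by fun_prop
  have := Measure.isProbabilityMeasure_map (μ := Measure.pi fun _ : ι => complexGaussian)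
    hm.aemeasurable
  refine Measure.ext_of_charFun ?_
  have hind : iIndepFun (fun n (x : ι → ℂ) => c n * x n)
      (Measure.pi fun _ : ι => complexGaussian) :=
    iIndepFun_pi (X := fun n z => c n * z) fun n => by fun_prop
  rw [hind.charFun_map_fun_sum_eq_prod fun n => Measurable.aemeasurable (by fun_prop)]
  funext w
  have hfac : ∀ n, charFun ((Measure.pi fun _ : ι => complexGaussian).map
      fun x => c n * x n) w = Complex.exp (-(‖c n‖ ^ 2 * ‖w‖ ^ 2 / 4 : ℝ)) := by
    intro n
    have h1 : (Measure.pi fun _ : ι => complexGaussian).map (fun x => c n * x n) =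
        complexGaussian.map (fun z => c n * z) :=
      map_comp_eval_complexGaussian (by fun_prop) n
    -- Multiplication by `c n` moves to the other side of the inner product as its conjugate.
    have h2 : ‖c n‖ ^ 2 * ‖w‖ ^ 2 / 4 = ‖star (c n) * w‖ ^ 2 / 4 := by
      rw [norm_mul, norm_star, mul_pow]
    rw [h1, h2, ← charFun_complexGaussian, charFun_apply, charFun_apply,
      integral_map (by fun_prop) (by fun_prop)]
    refine integral_congr_ae (ae_of_all _ fun z => ?_)
    simp only [Complex.inner]
    congr 4
    simp
    ring
  rw [Finset.prod_apply, Finset.prod_congr rfl fun n _ => hfac n, ← Complex.exp_sum,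
    charFun_complexGaussian]
  congr 1
  rw [Finset.sum_neg_distrib, ← Complex.ofReal_sum, ← Finset.sum_div, ← Finset.sum_mul, hc, one_mul]

lemma integrable_exp_mul_erlang {t : ℝ} (ht : t < 1) (n : ℕ) :
    Integrable (fun x => Real.exp (t * x)) (erlang n) := by
  rw [erlang, integrable_withDensity_iff_integrable_smul₀' (by fun_prop) (by simp)]
  refine IntegrableOn.congr_fun (integrable_erlangPDF_mul_exp n ht) (fun x hx => ?_)
    measurableSet_Ioi
  simp only [ENNReal.toReal_ofReal (erlangPDF_nonneg n (le_of_lt hx)), smul_eq_mul]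

lemma mgf_erlang {t : ℝ} (ht : t < 1) (n : ℕ) :
    mgf id (erlang n) t = ((1 - t)⁻¹) ^ (n + 1) := by
  have h := integral_cexp_mul_pow_mul_exp_neg n (z := (t : ℂ)) (by simpa using ht)
  rw [mgf, erlang, integral_withDensity_eq_integral_toReal_smul₀ (by fun_prop) (by simp)]
  refine Complex.ofReal_injective ?_
  refine (integral_ofReal (𝕜 := ℂ)).symm.trans ?_
  push_cast
  rw [← h]
  refine setIntegral_congr_fun measurableSet_Ioi fun x hx => ?_
  simp [ENNReal.toReal_ofReal (erlangPDF_nonneg n (le_of_lt hx))]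

lemma integrable_exp_mul_norm_sq {t : ℝ} (ht : t < 1) :
    Integrable (fun z => Real.exp (t * ‖z‖ ^ 2)) complexGaussian := by
  have h := integrable_exp_mul_erlang ht 0
  rw [← map_norm_sq_complexGaussian] at h
  exact h.comp_measurable (by fun_prop)

lemma mgf_norm_sq_complexGaussian {t : ℝ} (ht : t < 1) :
    mgf (fun z => ‖z‖ ^ 2) complexGaussian t = (1 - t)⁻¹ := by
  rw [← mgf_id_map (by fun_prop), map_norm_sq_complexGaussian, mgf_erlang ht, zero_add, pow_one]

end ComplexGaussian

/-! ### Exponential moments of weighted sums of squared moduli. -/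

section WeightedSum

variable {ι : Type*} [Fintype ι]

lemma mgf_mul_norm_sq_eval (d : ι → ℝ) (i : ι) {t : ℝ} (ht : t * d i < 1) :
    Integrable (fun v : ι → ℂ => Real.exp (t * (d i * ‖v i‖ ^ 2)))
        (Measure.pi fun _ : ι => complexGaussian) ∧
      mgf (fun v : ι → ℂ => d i * ‖v i‖ ^ 2) (Measure.pi fun _ : ι => complexGaussian) t =
        (1 - t * d i)⁻¹ := by
  have hmp := measurePreserving_eval (fun _ : ι => complexGaussian) i
  constructor
  · have h2 := hmp.integrable_comp_of_integrable (integrable_exp_mul_norm_sq ht)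
    refine h2.congr (ae_of_all _ fun v => ?_)
    simp only [Function.comp_apply, mul_assoc, Function.eval]
  · rw [mgf_const_mul, mul_comm (d i), ← mgf_norm_sq_complexGaussian ht]
    conv_rhs => rw [← hmp.map_eq]
    rw [mgf_map hmp.measurable.aemeasurable (by fun_prop)]
    rfl

lemma iIndepFun_mul_norm_sq (d : ι → ℝ) :
    iIndepFun (fun i (v : ι → ℂ) => d i * ‖v i‖ ^ 2)
      (Measure.pi fun _ : ι => complexGaussian) :=
  iIndepFun_pi (X := fun i z => d i * ‖z‖ ^ 2) fun i => by fun_prop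

lemma eventually_mul_lt_one (d : ι → ℝ) : ∀ᶠ t in 𝓝 (0 : ℝ), ∀ i, t * d i < 1 := by
  rw [Filter.eventually_all]
  intro i
  have hc : ContinuousAt (fun t : ℝ => t * d i) 0 := by fun_prop
  exact hc.eventually_lt_const (by simp)

/-- Exponential moments exist on both sides of `0`; this makes all moments finite and lets them be
read off as derivatives. -/
lemma zero_mem_interior_integrableExpSet (d : ι → ℝ) :
    0 ∈ interior (integrableExpSet (fun v : ι → ℂ => ∑ i, d i * ‖v i‖ ^ 2)
      (Measure.pi fun _ : ι => complexGaussian)) := by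
  rw [mem_interior_iff_mem_nhds]
  filter_upwards [eventually_mul_lt_one d] with t ht
  have := (iIndepFun_mul_norm_sq d).integrable_exp_mul_sum (t := t) (fun i => by fun_prop)
    (s := Finset.univ) fun i _ => (mgf_mul_norm_sq_eval d i (ht i)).1
  refine this.congr (ae_of_all _ fun v => ?_)
  simp

lemma eventually_mgf_eq (d : ι → ℝ) :
    ∀ᶠ t in 𝓝 (0 : ℝ), mgf (fun v : ι → ℂ => ∑ i, d i * ‖v i‖ ^ 2)
      (Measure.pi fun _ : ι => complexGaussian) t = ∏ i, (1 - t * d i)⁻¹ := by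
  filter_upwards [eventually_mul_lt_one d] with t ht
  have h := (iIndepFun_mul_norm_sq d).mgf_sum (t := t) (fun i => by fun_prop) Finset.univ
  have h2 : (fun v : ι → ℂ => ∑ i, d i * ‖v i‖ ^ 2) =
      ∑ i, fun v : ι → ℂ => d i * ‖v i‖ ^ 2 := by
    funext v
    simp
  rw [h2, h]
  exact Finset.prod_congr rfl fun i _ => (mgf_mul_norm_sq_eval d i (ht i)).2

end WeightedSum

/-- The characteristic function is the `(n + 1)`-fold product of the exponential one. -/
lemma map_sqNorm_complexGaussian (n : ℕ) :
    (Measure.pi fun _ : Fin (n + 1) => complexGaussian).map sqNorm = erlang n := by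
  have hm : Measurable (sqNorm : (Fin (n + 1) → ℂ) → ℝ) := by
    unfold sqNorm
    fun_prop
  have := Measure.isProbabilityMeasure_map
    (μ := Measure.pi fun _ : Fin (n + 1) => complexGaussian) hm.aemeasurable
  refine Measure.ext_of_charFun ?_
  have hind : iIndepFun (fun i (x : Fin (n + 1) → ℂ) => ‖x i‖ ^ 2)
      (Measure.pi fun _ : Fin (n + 1) => complexGaussian) :=
    iIndepFun_pi (X := fun _ z => ‖z‖ ^ 2) fun i => by fun_prop
  have h := hind.charFun_map_fun_sum_eq_prod fun i => Measurable.aemeasurable (by fun_prop)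
  have hi : ∀ i, (Measure.pi fun _ : Fin (n + 1) => complexGaussian).map (fun x => ‖x i‖ ^ 2) =
      erlang 0 := by
    intro i
    rw [← map_norm_sq_complexGaussian]
    exact map_comp_eval_complexGaussian (f := fun z => ‖z‖ ^ 2) (by fun_prop) i
  simp only [hi] at h
  refine h.trans (funext fun t => ?_)
  simp [charFun_erlang]


/-! ### The law of the combined interference and its moments. -/

/-- The law of one plus the total interference-to-noise ratio after combining, where `d` lists the
interference-to-noise ratios. -/
def interferenceLaw {M : ℕ} (d : Fin M → ℝ) : Measure ℝ :=
  (Measure.pi fun _ : Fin M => complexGaussian).map fun v => 1 + ∑ i, d i * ‖v i‖ ^ 2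

section InterferenceLaw

variable {M : ℕ} (d : Fin M → ℝ)

lemma measurable_interference :
    Measurable fun v : Fin M → ℂ => 1 + ∑ i, d i * ‖v i‖ ^ 2 := by
  fun_prop

instance : IsProbabilityMeasure (interferenceLaw d) :=
  Measure.isProbabilityMeasure_map (measurable_interference d).aemeasurable

variable {d}

lemma ae_one_le_interferenceLaw (hd : ∀ i, 0 < d i) : ∀ᵐ u ∂interferenceLaw d, 1 ≤ u := by
  rw [interferenceLaw, ae_map_iff (measurable_interference d).aemeasurable measurableSet_Ici]
  refine ae_of_all _ fun v => le_add_of_nonneg_right (Finset.sum_nonneg fun i _ => ?_)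
  have := hd i
  positivity

variable (d) in
lemma integrable_pow_interferenceLaw (k : ℕ) : Integrable (fun u => u ^ k) (interferenceLaw d) := by
  rw [interferenceLaw, integrable_map_measure (by fun_prop)
    (measurable_interference d).aemeasurable]
  exact integrable_one_add_pow (zero_mem_interior_integrableExpSet d) k

lemma mrcBracket_eq (hM : 1 ≤ M) (hd : ∀ i, 0 < d i) (N : ℕ) (μ : ℝ) :
    mrcBracket N μ d = 1 / μ ^ N + ∫ u, u ^ N ∂interferenceLaw d := by
  rw [interferenceLaw, integral_map (measurable_interference d).aemeasurable (by fun_prop)]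
  exact mrcBracket_eq_integral hM (fun i => (hd i).ne') (zero_mem_interior_integrableExpSet d)
    (eventually_mgf_eq d) N μ

lemma integral_pow_interferenceLaw_of_isEmpty (d : Fin 0 → ℝ) (N : ℕ) :
    ∫ u, u ^ N ∂interferenceLaw d = 1 := by
  rw [interferenceLaw, integral_map (measurable_interference d).aemeasurable (by fun_prop)]
  simp

/-- One interferer of positive power already pushes the variable above `1` almost surely. This is
the source of the strict loss in array gain. -/
lemma one_lt_integral_pow_interferenceLaw (hM : 1 ≤ M) (hd : ∀ i, 0 < d i) {N : ℕ} (hN : 1 ≤ N) :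
    1 < ∫ u, u ^ N ∂interferenceLaw d := by
  have h0 : ∀ᵐ v ∂(Measure.pi fun _ : Fin M => complexGaussian), 0 < ‖v ⟨0, hM⟩‖ ^ 2 := by
    have h := ae_pos_erlang 0
    rw [← map_norm_sq_complexGaussian,
      ← map_comp_eval_complexGaussian (f := fun z => ‖z‖ ^ 2) (by fun_prop) (⟨0, hM⟩ : Fin M)] at h
    exact ae_of_ae_map (Measurable.aemeasurable (by fun_prop)) h
  have hlt : ∀ᵐ u ∂interferenceLaw d, 1 < u := by
    rw [interferenceLaw, ae_map_iff (measurable_interference d).aemeasurable measurableSet_Ioi]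
    filter_upwards [h0] with v hv
    refine lt_add_of_pos_right _ (Finset.sum_pos' (fun i _ => ?_)
      ⟨⟨0, hM⟩, Finset.mem_univ _, mul_pos (hd _) hv⟩)
    have := hd i
    positivity
  have hpow : ∀ᵐ u ∂interferenceLaw d, 0 < u ^ N - 1 := by
    filter_upwards [hlt] with u hu
    exact sub_pos.2 (one_lt_pow₀ hu (by omega))
  have hint : Integrable (fun u => u ^ N - 1) (interferenceLaw d) :=
    (integrable_pow_interferenceLaw d N).sub (integrable_const 1)
  have hpos : 0 < ∫ u, (u ^ N - 1) ∂interferenceLaw d := by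
    rw [integral_pos_iff_support_of_nonneg_ae (hpow.mono fun u hu => hu.le) hint]
    have : Function.support (fun u : ℝ => u ^ N - 1) =ᵐ[interferenceLaw d] Set.univ := by
      filter_upwards [hpow] with u hu
      exact propext ⟨fun _ => trivial, fun _ => hu.ne'⟩
    rw [measure_congr this]
    simp
  rw [integral_sub (integrable_pow_interferenceLaw d N) (integrable_const 1)] at hpos
  simpa using hpos

end InterferenceLaw

/-! ### Reduction of the SINR to scalar gains. -/

section SINR

variable {N M : ℕ}

lemma measurable_sqNorm : Measurable (sqNorm : (Fin N → ℂ) → ℝ) := by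
  unfold sqNorm
  fun_prop

lemma sqNorm_nonneg (v : Fin N → ℂ) : 0 ≤ sqNorm v :=
  Finset.sum_nonneg fun _ _ => by positivity

lemma star_dotProduct_self_eq_sqNorm (v : Fin N → ℂ) : star v ⬝ᵥ v = (sqNorm v : ℂ) := by
  simp only [dotProduct, sqNorm, Pi.star_apply, RCLike.star_def, Complex.conj_mul']
  push_cast
  rfl

/-- One plus the interference-to-noise ratio at the relay after maximum ratio combining. -/
def combinedInterference (d : Fin M → ℝ) (h₁ : Fin N → ℂ) (hI : Fin M → Fin N → ℂ) : ℝ :=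
  1 + (∑ i, d i * ‖star h₁ ⬝ᵥ hI i‖ ^ 2) / sqNorm h₁

lemma one_le_combinedInterference {d : Fin M → ℝ} (hd : ∀ i, 0 < d i) (h₁ : Fin N → ℂ)
    (hI : Fin M → Fin N → ℂ) : 1 ≤ combinedInterference d h₁ hI := by
  refine le_add_of_nonneg_right (div_nonneg (Finset.sum_nonneg fun i _ => ?_) (sqNorm_nonneg _))
  have := hd i
  positivity

lemma dotProduct_star_div_sqrt_sqNorm (v : Fin N → ℂ) :
    v ⬝ᵥ (fun n => star (v n) / ((Real.sqrt (sqNorm v) : ℝ) : ℂ)) =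
      ((Real.sqrt (sqNorm v) : ℝ) : ℂ) := by
  have h1 : v ⬝ᵥ (fun n => star (v n) / ((Real.sqrt (sqNorm v) : ℝ) : ℂ)) =
      (star v ⬝ᵥ v) / ((Real.sqrt (sqNorm v) : ℝ) : ℂ) := by
    simp only [dotProduct, Finset.sum_div, Pi.star_apply]
    exact Finset.sum_congr rfl fun n _ => by ring
  rw [h1, star_dotProduct_self_eq_sqNorm, ← Complex.ofReal_div, Real.div_sqrt]

lemma star_div_sqrt_sqNorm_dotProduct (v w : Fin N → ℂ) :
    (fun n => star (v n) / ((Real.sqrt (sqNorm v) : ℝ) : ℂ)) ⬝ᵥ w =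
      (star v ⬝ᵥ w) / ((Real.sqrt (sqNorm v) : ℝ) : ℂ) := by
  simp only [dotProduct, Finset.sum_div, Pi.star_apply]
  exact Finset.sum_congr rfl fun n _ => by ring

lemma sqNorm_smul (c : ℂ) (v : Fin N → ℂ) : sqNorm (c • v) = ‖c‖ ^ 2 * sqNorm v := by
  simp only [sqNorm, Finset.mul_sum, Pi.smul_apply, smul_eq_mul, norm_mul, mul_pow]

/-- The quotient is not simplified to `1`, so that the identity covers `v = 0`, where division by
zero gives `0`. -/
lemma sqNorm_star_div_sqrt_sqNorm (v : Fin N → ℂ) :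
    sqNorm (fun n => star (v n) / ((Real.sqrt (sqNorm v) : ℝ) : ℂ)) = sqNorm v / sqNorm v := by
  have h : ∀ n, ‖star (v n) / ((Real.sqrt (sqNorm v) : ℝ) : ℂ)‖ ^ 2 = ‖v n‖ ^ 2 / sqNorm v := by
    intro n
    rw [norm_div, norm_star, div_pow, Complex.norm_real, Real.norm_of_nonneg (Real.sqrt_nonneg _),
      Real.sq_sqrt (sqNorm_nonneg v)]
  rw [sqNorm]
  simp only [h]
  rw [← Finset.sum_div]
  rfl

/-- The SINR of the MRC/MRT scheme in terms of the channel gains of the two hops and of the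
interference power after combining. -/
lemma mrcSINR_eq {ρ μ N₀ : ℝ} (hρ : 0 < ρ) (hμ : 0 < μ) (hN₀ : 0 < N₀) {d : Fin M → ℝ}
    (hd : ∀ i, 0 < d i) (h₁ h₂ : Fin N → ℂ) (hI : Fin M → Fin N → ℂ) :
    mrcSINR (ρ * N₀) (μ * ρ * N₀) (fun i => d i * N₀) N₀ h₁ h₂ hI =
      ρ * sqNorm h₁ * (μ * ρ * sqNorm h₂) /
        (μ * ρ * sqNorm h₂ * combinedInterference d h₁ hI + ρ * sqNorm h₁ +
          combinedInterference d h₁ hI) := by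
  set X := sqNorm h₁ with hX
  set Y := sqNorm h₂ with hY
  set U := combinedInterference d h₁ hI with hU
  have hX0 : 0 ≤ X := sqNorm_nonneg h₁
  have hY0 : 0 ≤ Y := sqNorm_nonneg h₂
  have hU1 : 1 ≤ U := one_le_combinedInterference hd h₁ hI
  set w := mrcScalingSq (ρ * N₀) (μ * ρ * N₀) (fun i => d i * N₀) N₀ h₁ hI with hw
  have hsum : ∑ i, ‖star h₁ ⬝ᵥ hI i‖ ^ 2 * (d i * N₀) =
      (∑ i, d i * ‖star h₁ ⬝ᵥ hI i‖ ^ 2) * N₀ := by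
    rw [Finset.sum_mul]
    exact Finset.sum_congr rfl fun i _ => by ring
  have hw' : w = μ * ρ / (ρ * X + U) := by
    rw [hw, mrcScalingSq, hsum, ← hX, hU, combinedInterference, ← hX]
    have : X * (ρ * N₀) + (∑ i, d i * ‖star h₁ ⬝ᵥ hI i‖ ^ 2) * N₀ / X + N₀ =
        (ρ * X + (1 + (∑ i, d i * ‖star h₁ ⬝ᵥ hI i‖ ^ 2) / X)) * N₀ := by ring
    rw [this, mul_div_mul_right _ _ hN₀.ne']
  have hD : 0 < ρ * X + U := by positivity
  have hw0 : 0 ≤ w := by rw [hw']; positivity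
  have hgain : ∀ v : Fin N → ℂ, ‖h₂ ⬝ᵥ (mrcPrecoder (ρ * N₀) (μ * ρ * N₀) (fun i => d i * N₀) N₀
      h₁ h₂ hI).mulVec v‖ ^ 2 = w * Y * (‖star h₁ ⬝ᵥ v‖ ^ 2 / X) := by
    intro v
    rw [mrcPrecoder, Matrix.smul_mulVec, Matrix.vecMulVec_mulVec, dotProduct_smul, ← hw,
      op_smul_eq_smul, dotProduct_smul,
      dotProduct_star_div_sqrt_sqNorm, star_div_sqrt_sqNorm_dotProduct]
    simp only [smul_eq_mul, norm_mul, norm_div, Complex.norm_real,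
      Real.norm_of_nonneg (Real.sqrt_nonneg _), mul_pow, div_pow]
    rw [Real.sq_sqrt hw0, Real.sq_sqrt hX0, Real.sq_sqrt hY0]
    ring
  have hnoise : sqNorm (Matrix.vecMul h₂ (mrcPrecoder (ρ * N₀) (μ * ρ * N₀) (fun i => d i * N₀) N₀
      h₁ h₂ hI)) = w * Y * (X / X) := by
    rw [mrcPrecoder, Matrix.vecMul_smul, Matrix.vecMul_vecMulVec, sqNorm_smul, sqNorm_smul,
      ← hw, dotProduct_star_div_sqrt_sqNorm, sqNorm_star_div_sqrt_sqNorm, Complex.norm_real,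
      Complex.norm_real, Real.norm_of_nonneg (Real.sqrt_nonneg _),
      Real.norm_of_nonneg (Real.sqrt_nonneg _), Real.sq_sqrt hw0, Real.sq_sqrt hY0]
    ring
  have hself : ‖star h₁ ⬝ᵥ h₁‖ ^ 2 / X = X := by
    rw [star_dotProduct_self_eq_sqNorm, Complex.norm_real, Real.norm_of_nonneg hX0, sq]
    exact mul_self_div_self X
  rw [mrcSINR, endToEndSINR, hnoise, hgain, hself]
  simp only [hgain]
  -- For `X = 0` both numerators vanish.
  rcases eq_or_ne X 0 with h0 | h0
  · simp [h0]
  have hsum2 : ∑ i, w * Y * (‖star h₁ ⬝ᵥ hI i‖ ^ 2 / X) * (d i * N₀) = w * Y * (U - 1) * N₀ := by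
    rw [hU, combinedInterference, add_sub_cancel_left, ← hX, Finset.sum_div, Finset.mul_sum,
      Finset.sum_mul]
    exact Finset.sum_congr rfl fun i _ => by ring
  have hden : w * Y * (U - 1) * N₀ + w * Y * (X / X) * N₀ + N₀ = (w * Y * U + 1) * N₀ := by
    rw [div_self h0]
    ring
  rw [hsum2, hden, ← mul_assoc, mul_div_mul_right _ _ hN₀.ne', hw']
  have h1 : 0 < μ * ρ / (ρ * X + U) * Y * U + 1 := by positivity
  have h2 : 0 < μ * ρ * Y * U + ρ * X + U := by positivity
  rw [div_eq_div_iff h1.ne' h2.ne']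
  field_simp
  ring

/-- The outage event in terms of the channel gains. -/
lemma mrcSINR_lt_iff {ρ μ N₀ t : ℝ} (hρ : 0 < ρ) (hμ : 0 < μ) (hN₀ : 0 < N₀) (_ : 0 < t)
    {d : Fin M → ℝ} (hd : ∀ i, 0 < d i) (h₁ h₂ : Fin N → ℂ) (hI : Fin M → Fin N → ℂ) :
    mrcSINR (ρ * N₀) (μ * ρ * N₀) (fun i => d i * N₀) N₀ h₁ h₂ hI < t ↔
      (sqNorm h₁ - t / ρ * combinedInterference d h₁ hI) * (sqNorm h₂ - t / ρ / μ) <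
        (t + 1) / (t * μ) * (t / ρ) ^ 2 * combinedInterference d h₁ hI := by
  rw [mrcSINR_eq hρ hμ hN₀ hd]
  have hX0 : 0 ≤ sqNorm h₁ := sqNorm_nonneg h₁
  have hY0 : 0 ≤ sqNorm h₂ := sqNorm_nonneg h₂
  have hU1 : 1 ≤ combinedInterference d h₁ hI := one_le_combinedInterference hd h₁ hI
  generalize sqNorm h₁ = X at *
  generalize sqNorm h₂ = Y at *
  generalize combinedInterference d h₁ hI = U at *
  have hD : 0 < μ * ρ * Y * U + ρ * X + U := by positivity
  rw [div_lt_iff₀ hD, ← sub_pos, ← sub_pos (a := _ * _ * U)]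
  -- Completing the product in the outage inequality and dividing by `μ ρ²` gives the factored form;
  -- `(t + 1) / (t μ)` is what remains.
  have : (t + 1) / (t * μ) * (t / ρ) ^ 2 * U - (X - t / ρ * U) * (Y - t / ρ / μ) =
      (t * (μ * ρ * Y * U + ρ * X + U) - ρ * X * (μ * ρ * Y)) / (μ * ρ ^ 2) := by
    field_simp
    ring
  rw [this, div_pos_iff_of_pos_right (by positivity)]

end SINR

/-! ### Independence of gains and combined interference. -/

section JointLaw

variable {N M : ℕ}

/-- Projecting independent Gaussian vectors on a fixed unit vector gives i.i.d. `CN(0,1)` variables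
whatever the direction, so the law does not depend on `h₁`. -/
lemma map_combinedInterference (d : Fin M → ℝ) {h₁ : Fin N → ℂ} (h0 : 0 < sqNorm h₁) :
    (Measure.pi fun _ : Fin M × Fin N => complexGaussian).map
      (fun x => combinedInterference d h₁ fun i n => x (i, n)) = interferenceLaw d := by
  have hcurry : MeasurePreserving (MeasurableEquiv.curry (Fin M) (Fin N) ℂ)
      (Measure.pi fun _ : Fin M × Fin N => complexGaussian)
      (Measure.pi fun _ : Fin M => Measure.pi fun _ : Fin N => complexGaussian) := by
    refine ⟨MeasurableEquiv.measurable _, ?_⟩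
    have := Measure.infinitePi_map_curry (fun (_ : Fin M) (_ : Fin N) => complexGaussian)
    simpa only [Measure.infinitePi_eq_pi] using this
  set c : Fin N → ℂ := fun n => star (h₁ n) / ((Real.sqrt (sqNorm h₁) : ℝ) : ℂ) with hc
  have hc1 : ∑ n, ‖c n‖ ^ 2 = 1 := by
    have := sqNorm_star_div_sqrt_sqNorm h₁
    rw [div_self h0.ne'] at this
    exact this
  have hcomb : MeasurePreserving (fun (a : Fin M → Fin N → ℂ) i => ∑ n, c n * a i n)
      (Measure.pi fun _ : Fin M => Measure.pi fun _ : Fin N => complexGaussian)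
      (Measure.pi fun _ : Fin M => complexGaussian) :=
    measurePreserving_pi _ _ (f := fun _ (x : Fin N → ℂ) => ∑ n, c n * x n)
      fun _ => ⟨by fun_prop, map_sum_mul_complexGaussian hc1⟩
  have hfun : (fun x : Fin M × Fin N → ℂ => combinedInterference d h₁ fun i n => x (i, n)) =
      (fun v : Fin M → ℂ => 1 + ∑ i, d i * ‖v i‖ ^ 2) ∘
        (fun (a : Fin M → Fin N → ℂ) i => ∑ n, c n * a i n) ∘
          MeasurableEquiv.curry (Fin M) (Fin N) ℂ := by
    funext x
    have hi : ∀ i, ‖∑ n, c n * x (i, n)‖ ^ 2 =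
        ‖star h₁ ⬝ᵥ fun n => x (i, n)‖ ^ 2 / sqNorm h₁ := by
      intro i
      have := star_div_sqrt_sqNorm_dotProduct h₁ (fun n => x (i, n))
      rw [dotProduct] at this
      rw [hc, this, norm_div, div_pow, Complex.norm_real,
        Real.norm_of_nonneg (Real.sqrt_nonneg _), Real.sq_sqrt h0.le]
    simp only [combinedInterference, Function.comp_apply, MeasurableEquiv.coe_curry,
      Function.curry, hi, Finset.sum_div, mul_div_assoc]
  rw [hfun, ← Measure.map_map (measurable_interference d) (hcomb.comp hcurry).measurable,
    (hcomb.comp hcurry).map_eq]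
  rfl

lemma Measurable.combinedInterference {α : Type*} [MeasurableSpace α] (d : Fin M → ℝ)
    {f : α → Fin N → ℂ} {g : α → Fin M → Fin N → ℂ} (hf : Measurable f)
    (hg : ∀ i n, Measurable fun x => g x i n) :
    Measurable fun x => combinedInterference d (f x) (g x) := by
  have h : Measurable fun x => sqNorm (f x) := measurable_sqNorm.comp hf
  have h' : ∀ n, Measurable fun x => f x n := fun n => (measurable_pi_apply n).comp hf
  simp only [_root_.combinedInterference, dotProduct, Pi.star_apply, RCLike.star_def]
  fun_prop

lemma measurePreserving_channels {Ω : Type*} [MeasurableSpace Ω] {P : Measure Ω}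
    [IsProbabilityMeasure P] {h₁ h₂ : Ω → Fin N → ℂ} {hI : Fin M → Ω → Fin N → ℂ}
    (hf : IsRayleighFading P h₁ h₂ hI) :
    MeasurePreserving (fun ω => (h₁ ω, h₂ ω, fun p : Fin M × Fin N => hI p.1 ω p.2)) P
      ((Measure.pi fun _ : Fin N => complexGaussian).prod
        ((Measure.pi fun _ : Fin N => complexGaussian).prod
          (Measure.pi fun _ : Fin M × Fin N => complexGaussian))) := by
  have hch : MeasurePreserving (fun ω k => channelEntries h₁ h₂ hI k ω) P
      (Measure.pi fun _ => complexGaussian) := by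
    refine ⟨measurable_pi_iff.2 hf.measurable, ?_⟩
    rw [(iIndepFun_iff_map_fun_eq_pi_map fun k => (hf.measurable k).aemeasurable).1 hf.indep]
    congr 1
    funext k
    exact hf.law k
  have hsplit := measurePreserving_sumPiEquivProdPi
    (fun _ : Fin N ⊕ Fin N ⊕ (Fin M × Fin N) => complexGaussian)
  have hsplit' := (MeasurePreserving.id (Measure.pi fun _ : Fin N => complexGaussian)).prod
    (measurePreserving_sumPiEquivProdPi
      (fun _ : Fin N ⊕ (Fin M × Fin N) => complexGaussian))
  exact hsplit'.comp (hsplit.comp hch)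

lemma measurePreserving_combinedInterference (d : Fin M → ℝ) {h₁ : Fin N → ℂ}
    (h0 : 0 < sqNorm h₁) :
    MeasurePreserving (fun x : Fin M × Fin N → ℂ => combinedInterference d h₁ fun i n => x (i, n))
      (Measure.pi fun _ => complexGaussian) (interferenceLaw d) := by
  exact ⟨Measurable.combinedInterference d measurable_const
    fun i n => measurable_pi_apply (i, n), map_combinedInterference d h0⟩

/-- The interference depends on `h₁`, but its conditional law is the same for almost every `h₁`; a
skew product therefore pushes forward to a plain product. The exceptional point is `h₁ = 0`. -/
lemma measurePreserving_gains (d : Fin M → ℝ) {ν : Measure ℝ} [SFinite ν]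
    (hnorm : MeasurePreserving (sqNorm : (Fin N → ℂ) → ℝ)
      (Measure.pi fun _ => complexGaussian) ν)
    (hpos : ∀ᵐ v ∂(Measure.pi fun _ : Fin N => complexGaussian), 0 < sqNorm v) :
    MeasurePreserving
      (fun q : (Fin N → ℂ) × (Fin N → ℂ) × (Fin M × Fin N → ℂ) =>
        (sqNorm q.1, sqNorm q.2.1, combinedInterference d q.1 fun i n => q.2.2 (i, n)))
      ((Measure.pi fun _ : Fin N => complexGaussian).prod
        ((Measure.pi fun _ : Fin N => complexGaussian).prod
          (Measure.pi fun _ : Fin M × Fin N => complexGaussian)))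
      (ν.prod (ν.prod (interferenceLaw d))) := by
  have hmeas : Measurable (Function.uncurry
      fun (v : Fin N → ℂ) (q : (Fin N → ℂ) × (Fin M × Fin N → ℂ)) =>
        (sqNorm q.1, combinedInterference d v fun i n => q.2 (i, n))) := by
    have h1 : Measurable fun q : (Fin N → ℂ) × (Fin N → ℂ) × (Fin M × Fin N → ℂ) =>
        sqNorm q.2.1 := measurable_sqNorm.comp (by fun_prop)
    exact h1.prodMk (Measurable.combinedInterference d measurable_fst
      fun i n => (measurable_pi_apply (i, n)).comp (measurable_snd.comp measurable_snd))
  refine MeasurePreserving.skew_product hnorm hmeas (hpos.mono fun v hv => ?_)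
  exact (hnorm.prod (measurePreserving_combinedInterference d hv)).map_eq

/-- The channel gains of the two hops and the interference power after combining are
independent. -/
lemma measurePreserving_channelGains {Ω : Type*} [MeasurableSpace Ω] {P : Measure Ω}
    [IsProbabilityMeasure P] {n : ℕ} {h₁ h₂ : Ω → Fin (n + 1) → ℂ}
    {hI : Fin M → Ω → Fin (n + 1) → ℂ}
    (hf : IsRayleighFading P h₁ h₂ hI) (d : Fin M → ℝ) :
    MeasurePreserving (fun ω => (sqNorm (h₁ ω), sqNorm (h₂ ω),
        combinedInterference d (h₁ ω) fun i => hI i ω)) P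
      ((erlang n).prod ((erlang n).prod (interferenceLaw d))) := by
  have hnorm : MeasurePreserving (sqNorm : (Fin (n + 1) → ℂ) → ℝ)
      (Measure.pi fun _ => complexGaussian) (erlang n) :=
    ⟨measurable_sqNorm, map_sqNorm_complexGaussian n⟩
  have hpos : ∀ᵐ v ∂(Measure.pi fun _ : Fin (n + 1) => complexGaussian), 0 < sqNorm v := by
    have h := ae_pos_erlang n
    rw [← map_sqNorm_complexGaussian] at h
    exact ae_of_ae_map measurable_sqNorm.aemeasurable h
  exact (measurePreserving_gains d hnorm hpos).comp (measurePreserving_channels hf)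

end JointLaw


/-! ### Expansion of the outage probability at high SNR. -/

section Outage

variable {Ω : Type*} [MeasurableSpace Ω] {P : Measure Ω} [IsProbabilityMeasure P] {n M : ℕ}
  {h₁ h₂ : Ω → Fin (n + 1) → ℂ} {hI : Fin M → Ω → Fin (n + 1) → ℂ}
  {N₀ μ t : ℝ} {d : Fin M → ℝ}

lemma mrcOutage_eq_real_prod (hf : IsRayleighFading P h₁ h₂ hI) (hN₀ : 0 < N₀) (hμ : 0 < μ)
    (ht : 0 < t) (hd : ∀ i, 0 < d i) {ρ : ℝ} (hρ : 0 < ρ) :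
    mrcOutage P h₁ h₂ hI (ρ * N₀) (μ * ρ * N₀) (fun i => d i * N₀) N₀ t =
      ((erlang n).prod ((erlang n).prod (interferenceLaw d))).real
        {q | (q.1 - t / ρ * q.2.2) * (q.2.1 - t / ρ / μ) <
          (t + 1) / (t * μ) * (t / ρ) ^ 2 * q.2.2} := by
  have hgain := measurePreserving_channelGains hf d
  rw [← hgain.map_eq, map_measureReal_apply hgain.measurable
    (measurableSet_lt (by fun_prop) (by fun_prop)), mrcOutage]
  congr 1
  ext ω
  exact mrcSINR_lt_iff hρ hμ hN₀ ht hd _ _ _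

/-- `Λ` stays free, and may vary with `ρ`, so that the bounded and the logarithmic case share one
estimate. -/
lemma exists_abs_mrcOutage_sub_le (hf : IsRayleighFading P h₁ h₂ hI) (hN₀ : 0 < N₀) (hμ : 0 < μ)
    (ht : 0 < t) (hd : ∀ i, 0 < d i) :
    ∃ K, 0 ≤ K ∧ ∀ ρ, t ≤ ρ → ∀ Λ, 0 ≤ Λ →
      truncatedNegMoment n (2 * (t / ρ / μ)) ≤ ENNReal.ofReal Λ →
      truncatedNegMoment n (2 * (t / ρ)) ≤ ENNReal.ofReal Λ →
      |mrcOutage P h₁ h₂ hI (ρ * N₀) (μ * ρ * N₀) (fun i => d i * N₀) N₀ t -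
        (1 / μ ^ (n + 1) + ∫ u, u ^ (n + 1) ∂interferenceLaw d) *
          ((t / ρ) ^ (n + 1) / ((n + 1)! : ℝ))| ≤ K * (t / ρ) ^ (n + 2) * (1 + Λ) := by
  have hk : 1 / μ < (t + 1) / (t * μ) := by
    rw [div_lt_div_iff₀ hμ (by positivity)]
    nlinarith
  obtain ⟨K, hK, h⟩ := abs_two_hop_outage_sub_le n (ae_one_le_interferenceLaw hd)
    (integrable_pow_interferenceLaw d (n + 1)) (integrable_pow_interferenceLaw d (n + 2)) hμ hk
  refine ⟨K, hK, fun ρ hρ Λ hΛ h1 h2 => ?_⟩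
  have hρ0 : 0 < ρ := ht.trans_le hρ
  rw [mrcOutage_eq_real_prod hf hN₀ hμ ht hd hρ0]
  exact h (t / ρ) (by positivity) ((div_le_one hρ0).2 hρ) Λ hΛ h1 h2

/-- With at least two relay antennas the first neglected order is the next power. -/
lemma isBigO_mrcOutage_sub (hf : IsRayleighFading P h₁ h₂ hI) (hN₀ : 0 < N₀) (hμ : 0 < μ)
    (ht : 0 < t) (hd : ∀ i, 0 < d i) (hn : 1 ≤ n) :
    (fun ρ => mrcOutage P h₁ h₂ hI (ρ * N₀) (μ * ρ * N₀) (fun i => d i * N₀) N₀ t -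
        (1 / μ ^ (n + 1) + ∫ u, u ^ (n + 1) ∂interferenceLaw d) *
          ((t / ρ) ^ (n + 1) / ((n + 1)! : ℝ))) =O[atTop] fun ρ : ℝ => (t / ρ) ^ (n + 2) := by
  obtain ⟨K, _, h⟩ := exists_abs_mrcOutage_sub_le hf hN₀ hμ ht hd
  obtain ⟨Λ, hΛ, hm⟩ := truncatedNegMoment_le_of_pos hn
  refine IsBigO.of_bound (K * (1 + Λ)) ?_
  filter_upwards [eventually_ge_atTop t] with ρ hρ
  have hρ0 : 0 < ρ := ht.trans_le hρ
  rw [Real.norm_eq_abs, Real.norm_of_nonneg (by positivity)]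
  exact (h ρ hρ Λ hΛ (hm _) (hm _)).trans_eq (by ring)

/-- In general the first neglected order is the next power up to a logarithm. -/
lemma isBigO_mrcOutage_sub_log (hf : IsRayleighFading P h₁ h₂ hI) (hN₀ : 0 < N₀) (hμ : 0 < μ)
    (ht : 0 < t) (hd : ∀ i, 0 < d i) :
    (fun ρ => mrcOutage P h₁ h₂ hI (ρ * N₀) (μ * ρ * N₀) (fun i => d i * N₀) N₀ t -
        (1 / μ ^ (n + 1) + ∫ u, u ^ (n + 1) ∂interferenceLaw d) *
          ((t / ρ) ^ (n + 1) / ((n + 1)! : ℝ))) =O[atTop]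
      fun ρ : ℝ => (t / ρ) ^ (n + 2) * Real.log ρ := by
  rcases Nat.eq_zero_or_pos n with rfl | hn
  · obtain ⟨K, hK, h⟩ := exists_abs_mrcOutage_sub_le hf hN₀ hμ ht hd
    -- `C` absorbs the constants left when `log ρ` is split off from the logarithms of the two
    -- truncation levels.
    set C := |2 * Real.log (μ / (2 * t))| + |2 * Real.log (1 / (2 * t))| with hC
    refine IsBigO.of_bound (K * (5 + 2 + C)) ?_
    filter_upwards [eventually_ge_atTop t, eventually_ge_atTop (2 * t),
      eventually_ge_atTop (2 * t / μ), eventually_ge_atTop (Real.exp 1)] with ρ hρ hρ2 hρμ hρe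
    have hρ0 : 0 < ρ := ht.trans_le hρ
    have hlog : 1 ≤ Real.log ρ := by rwa [Real.le_log_iff_exp_le hρ0]
    have hb : 2 * (t / ρ) ≤ 1 := by
      rw [← mul_div_assoc]
      exact (div_le_one hρ0).2 hρ2
    have hbμ : 2 * (t / ρ / μ) ≤ 1 := by
      have : 2 * (t / ρ / μ) = 2 * t / μ / ρ := by ring
      rw [this]
      exact (div_le_one hρ0).2 hρμ
    have e1 : Real.log (1 / (2 * (t / ρ / μ))) = Real.log (μ / (2 * t)) + Real.log ρ := by
      rw [← Real.log_mul (by positivity) hρ0.ne']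
      congr 1
      field_simp
    have e2 : Real.log (1 / (2 * (t / ρ))) = Real.log (1 / (2 * t)) + Real.log ρ := by
      rw [← Real.log_mul (by positivity) hρ0.ne']
      congr 1
      field_simp
    have hC0 : 0 ≤ C := by positivity
    have l1 := le_abs_self (2 * Real.log (μ / (2 * t)))
    have l2 := le_abs_self (2 * Real.log (1 / (2 * t)))
    have l3 := abs_nonneg (2 * Real.log (μ / (2 * t)))
    have l4 := abs_nonneg (2 * Real.log (1 / (2 * t)))
    have key := h ρ hρ (2 * Real.log ρ + 2 + C) (by linarith)
      ((truncatedNegMoment_zero_le (by positivity) hbμ).trans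
        (ENNReal.ofReal_le_ofReal (by rw [e1]; linarith)))
      ((truncatedNegMoment_zero_le (by positivity) hb).trans
        (ENNReal.ofReal_le_ofReal (by rw [e2]; linarith)))
    rw [Real.norm_eq_abs, Real.norm_of_nonneg (by positivity)]
    refine key.trans ?_
    have hKp : 0 ≤ K * (t / ρ) ^ (0 + 2) := by positivity
    have : 1 + (2 * Real.log ρ + 2 + C) ≤ (5 + 2 + C) * Real.log ρ := by nlinarith
    calc K * (t / ρ) ^ (0 + 2) * (1 + (2 * Real.log ρ + 2 + C))
        ≤ K * (t / ρ) ^ (0 + 2) * ((5 + 2 + C) * Real.log ρ) := by gcongr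
      _ = _ := by ring
  · refine (isBigO_mrcOutage_sub hf hN₀ hμ ht hd hn).trans (IsBigO.of_bound 1 ?_)
    filter_upwards [eventually_gt_atTop 0, eventually_ge_atTop (Real.exp 1)] with ρ hρ0 hρe
    have hlog : 1 ≤ Real.log ρ := by rwa [Real.le_log_iff_exp_le hρ0]
    rw [norm_mul, one_mul]
    exact le_mul_of_one_le_right (norm_nonneg _) (hlog.trans (le_abs_self _))

lemma isLittleO_mrcOutage_sub (hf : IsRayleighFading P h₁ h₂ hI) (hN₀ : 0 < N₀) (hμ : 0 < μ)
    (ht : 0 < t) (hd : ∀ i, 0 < d i) :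
    (fun ρ => mrcOutage P h₁ h₂ hI (ρ * N₀) (μ * ρ * N₀) (fun i => d i * N₀) N₀ t -
        (1 / μ ^ (n + 1) + ∫ u, u ^ (n + 1) ∂interferenceLaw d) *
          ((t / ρ) ^ (n + 1) / ((n + 1)! : ℝ))) =o[atTop] fun ρ : ℝ => (t / ρ) ^ (n + 1) := by
  refine (isBigO_mrcOutage_sub_log hf hN₀ hμ ht hd).trans_isLittleO ?_
  have h : (fun ρ : ℝ => t / ρ * Real.log ρ) =o[atTop] fun _ => (1 : ℝ) := by
    rw [isLittleO_one_iff]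
    have := (Real.isLittleO_log_id_atTop.tendsto_div_nhds_zero).const_mul t
    rw [mul_zero] at this
    exact this.congr fun ρ => by simp only [id]; ring
  refine ((isBigO_refl (fun ρ : ℝ => (t / ρ) ^ (n + 1)) atTop).mul_isLittleO h).congr
    (fun ρ => ?_) fun ρ => mul_one _
  ring

end Outage

/-! ### From the expansion to array gain and diversity order. -/

section DiversityOrder

/-- A high-SNR approximation `c ρ⁻ᴺ` of the outage probability determines the diversity order
and the array gain. -/
lemma hasArrayGain_of_isLittleO {Q : ℝ → ℝ} {N : ℕ} (hN : N ≠ 0) {t b : ℝ} (ht : 0 < t)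
    (hb : 0 < b)
    (h : (fun ρ => Q ρ - b * ((t / ρ) ^ N / (N ! : ℝ))) =o[atTop] fun ρ => (t / ρ) ^ N) :
    HasArrayGain Q N ((Real.Gamma ((N : ℝ) + 1) / b) ^ (1 / (N : ℝ)) / t) := by
  have hΓ : Real.Gamma ((N : ℝ) + 1) = N ! := Real.Gamma_nat_eq_factorial N
  have hN! : (0 : ℝ) < N ! := by positivity
  rw [hΓ]
  refine ⟨by positivity, ?_⟩
  -- The gain is chosen so that `(G ρ)⁻ᴺ` equals the leading term exactly, even at `ρ = 0`, where
  -- both are `0`.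
  have e : ∀ ρ : ℝ, ((((N ! : ℝ) / b) ^ (1 / (N : ℝ)) / t * ρ) ^ N)⁻¹ =
      b * ((t / ρ) ^ N / (N ! : ℝ)) := by
    intro ρ
    rw [mul_pow, div_pow, one_div, Real.rpow_inv_natCast_pow (by positivity) hN, div_pow]
    rcases eq_or_ne (ρ ^ N) 0 with h0 | h0
    · simp [h0]
    · field_simp
  rw [IsEquivalent]
  refine IsLittleO.trans_isBigO (g := fun ρ : ℝ => (t / ρ) ^ N)
    (h.congr_left fun ρ => by simp only [Pi.sub_apply, e]) (IsBigO.of_bound ((N ! : ℝ) / b) ?_)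
  refine Eventually.of_forall fun ρ => le_of_eq ?_
  rw [e, norm_mul, norm_div, Real.norm_of_nonneg hb.le, Real.norm_of_nonneg hN!.le]
  field_simp

/-- Taking logarithms of `Q = q (G ρ)⁻ᴺ` with `q → 1` leaves `N` plus a convergent quantity divided
by `log ρ`. -/
lemma HasArrayGain.hasDiversityOrder {Q : ℝ → ℝ} {N : ℕ} {G : ℝ} (h : HasArrayGain Q N G) :
    HasDiversityOrder Q N := by
  obtain ⟨hG, h⟩ := h
  have hne : ∀ᶠ ρ : ℝ in atTop, ((G * ρ) ^ N)⁻¹ ≠ 0 := by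
    filter_upwards [eventually_gt_atTop 0] with ρ hρ
    positivity
  have hratio : Tendsto (fun ρ => Q ρ / ((G * ρ) ^ N)⁻¹) atTop (𝓝 1) :=
    (isEquivalent_iff_tendsto_one hne).1 h
  have hlog := Real.tendsto_log_atTop
  have hlim : Tendsto (fun ρ => (N : ℝ) +
      (N * Real.log G - Real.log (Q ρ / ((G * ρ) ^ N)⁻¹)) / Real.log ρ) atTop (𝓝 (N + 0)) :=
    tendsto_const_nhds.add
      ((tendsto_const_nhds.sub (hratio.log one_ne_zero)).div_atTop hlog)
  rw [add_zero] at hlim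
  refine hlim.congr' ?_
  filter_upwards [eventually_gt_atTop 1, hratio.eventually_ne one_ne_zero] with ρ hρ hQ
  have hρ0 : 0 < ρ := one_pos.trans hρ
  have hl : Real.log ρ ≠ 0 := (Real.log_pos hρ).ne'
  have hq : ((G * ρ) ^ N)⁻¹ ≠ 0 := by positivity
  have hQ0 : Q ρ ≠ 0 := fun h0 => hQ (by rw [h0, zero_div])
  rw [Real.log_div hQ0 hq, Real.log_inv, Real.log_pow, Real.log_mul hG.ne' hρ0.ne']
  field_simp
  ring

end DiversityOrder

/-- The same system without interferers. -/
lemma IsRayleighFading.of_interference_free {Ω : Type*} [MeasurableSpace Ω] {P : Measure Ω}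
    {N M : ℕ} {h₁ h₂ : Ω → Fin N → ℂ} {hI : Fin M → Ω → Fin N → ℂ}
    (hf : IsRayleighFading P h₁ h₂ hI) :
    IsRayleighFading P h₁ h₂ (fun i : Fin 0 => i.elim0) := by
  -- The remaining entries form a subfamily along an injection of index sets, so independence is
  -- inherited.
  let g : Fin N ⊕ Fin N ⊕ (Fin 0 × Fin N) → Fin N ⊕ Fin N ⊕ (Fin M × Fin N) :=
    Sum.map id (Sum.map id fun p => p.1.elim0)
  have hg : g.Injective := Function.injective_id.sumMap
    (Function.injective_id.sumMap fun p => p.1.elim0)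
  have he : ∀ k, channelEntries h₁ h₂ (fun i : Fin 0 => i.elim0) k =
      channelEntries h₁ h₂ hI (g k) := by
    rintro (k | k | k)
    · rfl
    · rfl
    · exact k.1.elim0
  refine ⟨fun k => he k ▸ hf.measurable _, fun k => he k ▸ hf.law _, ?_⟩
  have := hf.indep.precomp hg
  rwa [show (fun k => channelEntries h₁ h₂ hI (g k)) = _ from (funext he).symm] at this

end

theorem theorem2 {Ω : Type*} [MeasurableSpace Ω] (P : Measure Ω) [IsProbabilityMeasure P]
    (N M : ℕ) (hN : 1 ≤ N) (hM : 1 ≤ M)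
    (h₁ h₂ : Ω → Fin N → ℂ) (hI : Fin M → Ω → Fin N → ℂ)
    (hfading : IsRayleighFading P h₁ h₂ hI)
    (N₀ : ℝ) (hN₀ : 0 < N₀) (μ : ℝ) (hμ : 0 < μ) (γth : ℝ) (hγ : 0 < γth)
    (ρI : Fin M → ℝ) (hρI : ∀ i, 0 < ρI i)
    -- outage probability as a function of `ρ₁`, where `Ps = ρ₁ N₀`, `Pr = μ ρ₁ N₀`, `PI = ρI N₀`
    (Pout : ℝ → ℝ)
    (hPout : Pout = fun ρ₁ =>
      mrcOutage P h₁ h₂ hI (ρ₁ * N₀) (μ * ρ₁ * N₀) (fun i => ρI i * N₀) N₀ γth)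
    -- outage probability of the same system without interferers
    (Pfree : ℝ → ℝ)
    (hPfree : Pfree = fun ρ₁ =>
      mrcOutage P h₁ h₂ (fun i : Fin 0 => i.elim0) (ρ₁ * N₀) (μ * ρ₁ * N₀)
        (fun i : Fin 0 => i.elim0) N₀ γth)
    -- remainder of the high-SNR approximation
    (R : ℝ → ℝ)
    (hR : R = fun ρ₁ =>
      Pout ρ₁ - mrcBracket N μ ρI * ((γth / ρ₁) ^ N / Real.Gamma ((N : ℝ) + 1))) :
    -- the high-SNR approximation, with the order of the remainder
    R =o[atTop] (fun ρ₁ : ℝ => (γth / ρ₁) ^ N) ∧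
    (2 ≤ N → R =O[atTop] (fun ρ₁ : ℝ => (γth / ρ₁) ^ (N + 1))) ∧
    (N = 1 → R =O[atTop] (fun ρ₁ : ℝ => (γth / ρ₁) ^ (N + 1) * Real.log ρ₁)) ∧
    -- the diversity order is `N`, with and without interference
    HasDiversityOrder Pout N ∧ HasDiversityOrder Pfree N ∧
    -- interference only changes (namely reduces) the array gain
    ∃ G Gfree : ℝ,
      G = (Real.Gamma ((N : ℝ) + 1) / mrcBracket N μ ρI) ^ (1 / (N : ℝ)) / γth ∧
      Gfree = (Real.Gamma ((N : ℝ) + 1) / (1 / μ ^ N + 1)) ^ (1 / (N : ℝ)) / γth ∧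
      HasArrayGain Pout N G ∧ HasArrayGain Pfree N Gfree ∧ G < Gfree := by
  -- `erlang n` has shape `n + 1`.
  obtain ⟨n, rfl⟩ : ∃ n, N = n + 1 := ⟨N - 1, by omega⟩
  have hΓ : Real.Gamma (((n + 1 : ℕ) : ℝ) + 1) = (n + 1)! := Real.Gamma_nat_eq_factorial (n + 1)
  have hB := mrcBracket_eq hM hρI (n + 1) μ
  have hmoment := one_lt_integral_pow_interferenceLaw hM hρI hN
  have hμN : 0 < 1 / μ ^ (n + 1) := by positivity
  have hR' : R = fun ρ => mrcOutage P h₁ h₂ hI (ρ * N₀) (μ * ρ * N₀) (fun i => ρI i * N₀) N₀ γth -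
        (1 / μ ^ (n + 1) + ∫ u, u ^ (n + 1) ∂interferenceLaw ρI) *
          ((γth / ρ) ^ (n + 1) / ((n + 1)! : ℝ)) := by
    rw [hR, hPout, hΓ, hB]
  have hRo : R =o[atTop] fun ρ₁ : ℝ => (γth / ρ₁) ^ (n + 1) := by
    rw [hR']
    exact isLittleO_mrcOutage_sub hfading hN₀ hμ hγ hρI
  have hout : HasArrayGain Pout (n + 1)
      ((Real.Gamma (((n + 1 : ℕ) : ℝ) + 1) / mrcBracket (n + 1) μ ρI) ^
        (1 / ((n + 1 : ℕ) : ℝ)) / γth) := by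
    refine hasArrayGain_of_isLittleO n.succ_ne_zero hγ (by rw [hB]; linarith) ?_
    rw [hR, hΓ] at hRo
    exact hRo
  have hfree : HasArrayGain Pfree (n + 1)
      ((Real.Gamma (((n + 1 : ℕ) : ℝ) + 1) / (1 / μ ^ (n + 1) + 1)) ^
        (1 / ((n + 1 : ℕ) : ℝ)) / γth) := by
    refine hasArrayGain_of_isLittleO n.succ_ne_zero hγ (by linarith) ?_
    have := isLittleO_mrcOutage_sub (d := fun i : Fin 0 => i.elim0) hfading.of_interference_free
      hN₀ hμ hγ fun i => i.elim0
    -- Without interferers `U = 1`, which yields the summand `1` of the interference-free constant.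
    rw [integral_pow_interferenceLaw_of_isEmpty] at this
    rw [hPfree, show (fun i : Fin 0 => (i.elim0 : ℝ)) = fun i : Fin 0 => i.elim0 * N₀ from
      funext fun i => i.elim0]
    exact this
  refine ⟨hRo, fun h2 => ?_, fun _ => ?_, hout.hasDiversityOrder, hfree.hasDiversityOrder,
    _, _, rfl, rfl, hout, hfree, ?_⟩
  · rw [hR']
    exact isBigO_mrcOutage_sub hfading hN₀ hμ hγ hρI (by omega)
  · rw [hR']
    exact isBigO_mrcOutage_sub_log hfading hN₀ hμ hγ hρI
  · have hG : (0 : ℝ) < Real.Gamma (((n + 1 : ℕ) : ℝ) + 1) := by rw [hΓ]; positivity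
    have hlt : Real.Gamma (((n + 1 : ℕ) : ℝ) + 1) / mrcBracket (n + 1) μ ρI <
        Real.Gamma (((n + 1 : ℕ) : ℝ) + 1) / (1 / μ ^ (n + 1) + 1) :=
      div_lt_div_of_pos_left hG (by linarith) (by rw [hB]; linarith)
    refine div_lt_div_of_pos_right (Real.rpow_lt_rpow (div_nonneg hG.le ?_) hlt (by positivity)) hγ
    rw [hB]
    linarith
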